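/- Let $\alpha,\beta\in\mathbb R$ not be negative integers, with $\alpha+\beta>-1$ (call such parameters admissible); put $$c_{\alpha,\beta}=\frac{\Gamma(\alpha+1)\Gamma(\beta+1)}{\Gamma(\alpha+\beta+1)},\qquad P_{\alpha,\beta}(z)=c_{\alpha,\beta}\frac{(1-|z|^2)^{\alpha+\beta+1}}{(1-z)^{\alpha+1}(1-\bar z)^{\beta+1}}\quad(|z|<1),$$ and for $f\in L^1(\mathbb T)$ let $P_{\alpha,\beta}[f](z)=\frac1{2\pi}\int_0^{2\pi}P_{\alpha,\beta}(ze^{-it})f(e^{it})\,dt$. Norms $\|f\|_p$ are taken in $L^p(\mathbb T)$ with respect to $dt/2\pi$. Let $1\le p\le\infty$ and $\frac1p+\frac1q=1$. Write $A=\alpha+\beta+2$, $w(s)=(1+r^2+2r\cos s)^{(Aq-2)/2}$ and $$I_{11}=\int_0^{2\pi}\big(A|\cos s|+|\alpha-\beta|\big)^q w(s)\,ds,\quad I_{12}=\int_0^{2\pi}w(s)\,ds,\quad I_{13}=\int_0^{2\pi}\big(|\alpha-\beta|+A|\sin s|\big)^q w(s)\,ds .$$ For $p>1$ and $0\le r<1$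 let $$C_{\alpha,\beta,p}(r)=|c_{\alpha,\beta}|\Big(\tfrac1{2\pi}I_{11}+\tfrac{q}{2\pi}\big(|\alpha+\beta|r+A+|\alpha-\beta|\big)^{q-1}|\alpha+\beta|\,r\,I_{12}\Big)^{1/q},$$ $$D_{\alpha,\beta,p}(r)=|c_{\alpha,\beta}|\,r\Big(\tfrac1{2\pi}I_{13}+\tfrac{q}{2\pi}\big(|\beta-\alpha|+A+|\beta-\alpha|r\big)^{q-1}|\beta-\alpha|\,r\,I_{12}\Big)^{1/q},$$ $$E_{\alpha,\beta,p}(r)=|c_{\alpha,\beta}|\big(|\alpha+1|+|\beta|r\big)\Big(\tfrac1{2\pi}I_{12}\Big)^{1/q},$$ and for $p=1$ let them be the limits of these expressions as $q\to\infty$, that is, $C_{\alpha,\beta,1}(r)=|c_{\alpha,\beta}|(|\alpha+\beta|r+A+|\alpha-\beta|)(1+r)^{A}$; $D_{\alpha,\beta,1}(r)=|c_{\alpha,\beta}|\,r\,(|\beta-\alpha|+A+|\beta-\alpha|r)(1+r)^{A}$ if $\alpha\ne\beta$, $D_{\alpha,\alpha,1}(r)=|c_{\alpha,\alpha}|\,r\,\sup_s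 A|\sin s|(1+r^2+2r\cos s)^{A/2}$; $E_{\alpha,\beta,1}(r)=|c_{\alpha,\beta}|(|\alpha+1|+|\beta|r)(1+r)^{A}$. Let $C_{\alpha,\beta,p}$, $D_{\alpha,\beta,p}$, $E_{\alpha,\beta,p}$ be the suprema of these functions over $r\in(0,1)$. Then for all admissible $\alpha,\beta$ these suprema are finite and $$E_{\alpha,\beta,p}=|c_{\alpha,\beta}|(|\alpha+1|+|\beta|)\Big(\frac{\Gamma(Aq-1)}{\Gamma(Aq/2)^2}\Big)^{1/q}\quad(p>1),\qquad E_{\alpha,\beta,1}=|c_{\alpha,\beta}|(|\alpha+1|+|\beta|)\,2^{A}.$$ For every complex-valued $f\in L^p(\mathbb T)$ the function $u=P_{\alpha,\beta}[f]$ is real-differentiable in the unit disk, and for all $z=re^{i\theta}$, $0\le r<1$: (1) $\displaystyle |u_r(z)|\le\frac{C_{\alpha,\beta,p}(r)}{(1-r^2)^{1+1/p}}\|f\|_p\le\frac{C_{\alpha,\beta,p}}{(1-r^2)^{1+1/p}}\|f\|_p$; (2) $\displaystyle |u_\theta(z)|\le\frac{D_{\alpha,\beta,p}(r)}{(1-r^2)^{1+1/p}}\|f\|_p\le\frac{D_{\alpha,\beta,p}}{(1-r^2)^{1+1/p}}\|f\|_p$;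 (3) $\displaystyle |u_z(z)|\le\frac{E_{\alpha,\beta,p}(r)}{(1-r^2)^{1+1/p}}\|f\|_p\le\frac{E_{\alpha,\beta,p}}{(1-r^2)^{1+1/p}}\|f\|_p$ and $\displaystyle |u_{\bar z}(z)|\le\frac{E_{\beta,\alpha,p}(r)}{(1-r^2)^{1+1/p}}\|f\|_p\le\frac{E_{\beta,\alpha,p}}{(1-r^2)^{1+1/p}}\|f\|_p$. If $\alpha=\beta$ (admissible), then $D_{\alpha,\alpha,p}$ is sharp, i.e. it is the smallest constant $K$ with $|u_\theta(re^{i\theta})|\le K(1-r^2)^{-(1+1/p)}\|f\|_p$ for all $f\in L^p(\mathbb T)$ and all $re^{i\theta}$ in the disk. The constants $C_{\alpha,\beta,p}$ (for $u_r$), $E_{\alpha,\beta,p}$ (for $u_z$) and $E_{\beta,\alpha,p}$ (for $u_{\bar z}$) are asymptotically sharp as $\alpha,\beta\to0$: at $\alpha=\beta=0$ each is the smallest possible constant in the same sense, each converges to its value at $\alpha=\beta=0$ as $(\alpha,\beta)\to(0,0)$, and for every $\varepsilon>0$ and all $(\alpha,\beta)$ close enough to $(0,0)$ each is at most $(1+\varepsilon)K$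 for every constant $K$ that is valid in the corresponding estimate for these $\alpha,\beta$. -/

import Mathlib

open MeasureTheory Set Filter Topology
open scoped ENNReal Real ComplexConjugate

noncomputable section

namespace AlphaBeta

/-- The standing assumptions on the parameters: neither `α` nor `β` is a negative integer, and
`α + β > -1`. -/
structure Admissible (α β : ℝ) : Prop where
  left : ∀ n : ℕ, α ≠ -((n : ℝ) + 1)
  right : ∀ n : ℕ, β ≠ -((n : ℝ) + 1)
  sum : -1 < α + β

/-- The normalizing constant `c_{α,β} = Γ(α+1) Γ(β+1) / Γ(α+β+1)`. -/
def normConst (α β : ℝ) : ℝ :=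
  Real.Gamma (α + 1) * Real.Gamma (β + 1) / Real.Gamma (α + β + 1)

/-- The `(α,β)`-harmonic Poisson kernel
`c_{α,β} (1 - |z|²)^(α+β+1) / ((1 - z)^(α+1) (1 - z̄)^(β+1))` (principal powers; for `|z| < 1` the
bases `1 - z` and `1 - z̄` have positive real part). -/
def poissonKernel (α β : ℝ) (z : ℂ) : ℂ :=
  (normConst α β : ℂ) * (((1 - ‖z‖ ^ 2) ^ (α + β + 1) : ℝ) : ℂ) /
    ((1 - z) ^ ((α + 1 : ℝ) : ℂ) * (1 - conj z) ^ ((β + 1 : ℝ) : ℂ))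

/-- The unit circle, parametrized by `t ↦ e^{it}`, `t ∈ ℝ / 2πℤ`. -/
abbrev T : Type := AddCircle (2 * π)

instance factTwoPiPos : Fact (0 < 2 * π) := ⟨Real.two_pi_pos⟩

/-- Normalized arc length `dt / 2π` on the circle. -/
abbrev m : Measure T := AddCircle.haarAddCircle

/-- The `(α,β)`-Poisson integral
`P_{α,β}[f](z) = ∫_𝕋 P_{α,β}(z ζ̄) f(ζ) dm(ζ)`. -/
def poissonIntegral (α β : ℝ) (f : T → ℂ) (z : ℂ) : ℂ :=
  ∫ t : T, poissonKernel α β (z * conj ((AddCircle.toCircle t : Circle) : ℂ)) * f t ∂m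

/-- The norm of `L^p(𝕋)` with respect to `m`, `1 ≤ p ≤ ∞`. -/
def lpNorm (p : ℝ≥0∞) (f : T → ℂ) : ℝ := (eLpNorm f p m).toReal

/-- The point `r e^{iθ}`. -/
def polar (r θ : ℝ) : ℂ := (r : ℂ) * Complex.exp (θ * Complex.I)

/-- `u_r` at `r e^{iθ}`. -/
def dR (u : ℂ → ℂ) (r θ : ℝ) : ℂ := deriv (fun ρ : ℝ => u (polar ρ θ)) r

/-- `u_θ` at `r e^{iθ}`. -/
def dTheta (u : ℂ → ℂ) (r θ : ℝ) : ℂ := deriv (fun φ : ℝ => u (polar r φ)) θ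

/-- `u_z = (u_x - i u_y) / 2`. -/
def dZ (u : ℂ → ℂ) (z : ℂ) : ℂ := (fderiv ℝ u z 1 - Complex.I * fderiv ℝ u z Complex.I) / 2

/-- `u_z̄ = (u_x + i u_y) / 2`. -/
def dZbar (u : ℂ → ℂ) (z : ℂ) : ℂ := (fderiv ℝ u z 1 + Complex.I * fderiv ℝ u z Complex.I) / 2

/-- The weight `(1 - r²)^(1 + 1/p)`, with `1/∞ = 0`. -/
def weight (p : ℝ≥0∞) (r : ℝ) : ℝ := (1 - r ^ 2) ^ (1 + (p⁻¹).toReal)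

/-- The conjugate exponent `q`, `1/p + 1/q = 1`, as a real number. It is used for `1 < p ≤ ∞` only
(for `p = 1` it would be infinite). -/
def conjExp (p : ℝ≥0∞) : ℝ := (1 - (p⁻¹).toReal)⁻¹

/-- `I₁₁(r) = ∫₀^{2π} ((α+β+2)|cos s| + |α-β|)^q (1 + r² + 2 r cos s)^(((α+β+2)q - 2)/2) ds`. -/
def I11 (α β q r : ℝ) : ℝ :=
  ∫ s in (0 : ℝ)..(2 * π), (|(α + β + 2) * Real.cos s| + |α - β|) ^ q *
    (1 + r ^ 2 + 2 * r * Real.cos s) ^ (((α + β + 2) * q - 2) / 2)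

/-- `I₁₂(r) = ∫₀^{2π} (1 + r² + 2 r cos s)^(((α+β+2)q - 2)/2) ds`. -/
def I12 (α β q r : ℝ) : ℝ :=
  ∫ s in (0 : ℝ)..(2 * π), (1 + r ^ 2 + 2 * r * Real.cos s) ^ (((α + β + 2) * q - 2) / 2)

/-- `I₁₃(r) = ∫₀^{2π} (|β-α| + (α+β+2)|sin s|)^q (1 + r² + 2 r cos s)^(((α+β+2)q - 2)/2) ds`. -/
def I13 (α β q r : ℝ) : ℝ :=
  ∫ s in (0 : ℝ)..(2 * π), (|β - α| + |(α + β + 2) * Real.sin s|) ^ q *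
    (1 + r ^ 2 + 2 * r * Real.cos s) ^ (((α + β + 2) * q - 2) / 2)

open Classical in
/-- The function `C_{α,β,p}(r)` in the bound for `u_r`. At `p = 1` it is the limit `q → ∞` of the
general expression. -/
def Cfun (α β : ℝ) (p : ℝ≥0∞) (r : ℝ) : ℝ :=
  if p = 1 then
    |normConst α β| * ((|α + β| * r + |α + β + 2| + |α - β|) * (1 + r) ^ (α + β + 2))
  else
    let q := conjExp p
    |normConst α β| * (1 / (2 * π) * I11 α β q r +
      q * (|α + β| * r + |α + β + 2| + |α - β|) ^ (q - 1) * |α + β| * r / (2 * π) *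
        I12 α β q r) ^ (1 / q)

open Classical in
/-- The function `D_{α,β,p}(r)` in the bound for `u_θ`. At `p = 1` it is the limit `q → ∞` of the
general expression (where, if `α = β`, the term with `I₁₂` vanishes for every `q`). -/
def Dfun (α β : ℝ) (p : ℝ≥0∞) (r : ℝ) : ℝ :=
  if p = 1 then
    if α = β then
      |normConst α β| * r *
        ⨆ s : ℝ, |(α + β + 2) * Real.sin s| *
          (1 + r ^ 2 + 2 * r * Real.cos s) ^ ((α + β + 2) / 2)
    else
      |normConst α β| * r *
        ((|β - α| + |α + β + 2| + |β - α| * r) * (1 + r) ^ (α + β + 2))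
  else
    let q := conjExp p
    |normConst α β| * r * (1 / (2 * π) * I13 α β q r +
      q * ((|β - α| + |α + β + 2| + |β - α| * r) ^ (q - 1) * |β - α| * r) / (2 * π) *
        I12 α β q r) ^ (1 / q)

open Classical in
/-- The function `E_{α,β,p}(r)` in the bound for `u_z`; the bound for `u_z̄` has `α` and `β`
interchanged. At `p = 1` it is the limit `q → ∞` of the general expression. -/
def Efun (α β : ℝ) (p : ℝ≥0∞) (r : ℝ) : ℝ :=
  if p = 1 then
    |normConst α β| * (|α + 1| + |β| * r) * (1 + r) ^ (α + β + 2)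
  else
    let q := conjExp p
    |normConst α β| * (|α + 1| + |β| * r) * (1 / (2 * π) * I12 α β q r) ^ (1 / q)

/-- `C_{α,β,p} = sup_{0<r<1} C_{α,β,p}(r)`. -/
def Cconst (α β : ℝ) (p : ℝ≥0∞) : ℝ := sSup (Cfun α β p '' Ioo 0 1)

/-- `D_{α,β,p} = sup_{0<r<1} D_{α,β,p}(r)`. -/
def Dconst (α β : ℝ) (p : ℝ≥0∞) : ℝ := sSup (Dfun α β p '' Ioo 0 1)

/-- `E_{α,β,p} = sup_{0<r<1} E_{α,β,p}(r)`. -/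
def Econst (α β : ℝ) (p : ℝ≥0∞) : ℝ := sSup (Efun α β p '' Ioo 0 1)

open Classical in
/-- The closed form of `E_{α,β,p}`; at `p = 1` again the limit `q → ∞`. -/
def Eclosed (α β : ℝ) (p : ℝ≥0∞) : ℝ :=
  if p = 1 then
    |normConst α β| * (|α + 1| + |β|) * 2 ^ (α + β + 2)
  else
    let q := conjExp p
    |normConst α β| * (|α + 1| + |β|) *
      (Real.Gamma ((α + β + 2) * q - 1) / Real.Gamma ((α + β + 2) * q / 2) ^ 2) ^ (1 / q)

/-- The constants `K` such that the quantity `Q u r θ` attached to `u = P_{α,β}[f]` at `r e^{iθ}`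
satisfies `|Q u r θ| ≤ K (1 - r²)^{-(1+1/p)} ‖f‖_p` for all `f ∈ L^p(𝕋)` and all `r e^{iθ}` in the
unit disk. -/
def validConstants (Q : (ℂ → ℂ) → ℝ → ℝ → ℂ) (p : ℝ≥0∞) (α β : ℝ) : Set ℝ :=
  {K | ∀ f : T → ℂ, MemLp f p m → ∀ r θ : ℝ, 0 ≤ r → r < 1 →
    ‖Q (poissonIntegral α β f) r θ‖ ≤ K / weight p r * lpNorm p f}

/-- The constants `K α β` in the above estimates are asymptotically sharp as `α, β → 0`: at
`α = β = 0` the constant is the best possible one, `K α β` tends to it, and `K α β` exceeds the best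
possible constant for the parameters `α, β` at most by a factor that tends to `1`. -/
def AsymptoticallySharp (Q : (ℂ → ℂ) → ℝ → ℝ → ℂ) (p : ℝ≥0∞) (K : ℝ → ℝ → ℝ) : Prop :=
  IsLeast (validConstants Q p 0 0) (K 0 0) ∧
  Tendsto (fun x : ℝ × ℝ => K x.1 x.2) (𝓝 (0, 0)) (𝓝 (K 0 0)) ∧
  ∀ ε : ℝ, 0 < ε → ∀ᶠ x : ℝ × ℝ in 𝓝 (0, 0),
    ∀ K' ∈ validConstants Q p x.1 x.2, K x.1 x.2 ≤ (1 + ε) * K'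

end AlphaBeta

end

noncomputable section

namespace AlphaBeta

/-! Each derivative of $u=P_{\alpha,\beta}[f]$ at $re^{i\theta}$ is a convolution on the circle of
$f$ with a continuous kernel `polarKernel`, so by $L^p$ duality its best pointwise bound is the
$L^q$ norm of that kernel (the sup norm if $p=1$).

The norm is computed through the substitution $e^{it}=(e^{is}+r)/(1+re^{is})$. It turns $1-re^{it}$
into $(1-r^2)/(1+re^{is})$, its Jacobian is $(1-r^2)/|1+re^{is}|^2$, and the bracket left over from
differentiation becomes the first-degree trigonometric polynomial `trigPoly`. All powers of $1-r^2$
then combine to $(1-r^2)^{-(1+1/p)}$, and what remains is the exact constant `sharpConst`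
(`norm_polarKernel_moebiusAngle`, `integral_norm_polarKernel_rpow`, `norm_polarIntegral_le`,
`sharpConst_le`).

The functions $C$, $D$, $E$ bound `sharpConst` from above by the triangle inequality for `trigPoly`.
For $C$ and $D$ with $p>1$ this is combined with $(a+b)^q\le a^q+qN^{q-1}b$, where $a+b\le N$. For
$D$ with $\alpha=\beta$, and for all of them at $\alpha=\beta=0$, `trigPoly` has a single term and
nothing is lost, which gives sharpness.

Finiteness of the suprema, and their continuity in $(\alpha,\beta)$ for $C$ and $E$, come from
continuity up to $r=1$. There the weight $|1+re^{is}|^{2\kappa}$, $\kappa=(Aq-2)/2>-\tfrac12$, is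
dominated uniformly in $r$ by means of $|1+re^{is}|\ge|\sin s|$ (`continuousAt_integral_distSq`).
The closed form of $E$ needs in addition that the circle means of $|1+z|^{2\kappa}$ increase with
the radius (`integral_distSq_mono`, by the maximum principle) and their value at $r=1$, a Beta
integral (`integral_distSq_one`).

For asymptotic sharpness, a function that nearly attains the best constant at $(0,0)$ is kept fixed
while the parameters move. The derivative of its Poisson integral depends continuously on them, and
so does the constant $K(\alpha,\beta)$ (`asymptoticallySharp_of_isLeast`). -/

/-! ### Wirtinger derivatives of the Poisson kernel -/

/-- The common factor `c (1 - |z|²)^(α+β) (1 - z)^(-α-1) (1 - z̄)^(-β-1)` of the Wirtinger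
derivatives of the Poisson kernel. -/
def coreKernel (α β : ℝ) (z : ℂ) : ℂ :=
  (normConst α β : ℂ) * (((1 - ‖z‖ ^ 2) ^ (α + β) : ℝ) : ℂ) /
    ((1 - z) ^ ((α + 1 : ℝ) : ℂ) * (1 - conj z) ^ ((β + 1 : ℝ) : ℂ))

/-- The derivative `∂P/∂z` of the Poisson kernel. -/
def kernelZ (α β : ℝ) (z : ℂ) : ℂ :=
  coreKernel α β z * ((α + 1) * (1 - conj z) / (1 - z) - β * conj z)

/-- The derivative `∂P/∂z̄` of the Poisson kernel. -/
def kernelZbar (α β : ℝ) (z : ℂ) : ℂ :=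
  coreKernel α β z * ((β + 1) * (1 - z) / (1 - conj z) - α * z)

theorem one_sub_mem_slitPlane {z : ℂ} (hz : ‖z‖ < 1) : 1 - z ∈ Complex.slitPlane := by
  left
  have := (abs_le.1 ((Complex.abs_re_le_norm z).trans hz.le)).2
  have h2 := (le_abs_self z.re).trans (Complex.abs_re_le_norm z)
  simp only [Complex.sub_re, Complex.one_re]
  linarith

theorem one_sub_conj_mem_slitPlane {z : ℂ} (hz : ‖z‖ < 1) : 1 - conj z ∈ Complex.slitPlane :=
  one_sub_mem_slitPlane (by simpa using hz)

theorem one_sub_norm_sq_pos {z : ℂ} (hz : ‖z‖ < 1) : 0 < 1 - ‖z‖ ^ 2 := by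
  nlinarith [norm_nonneg z]

/-- The product rule for $\partial_z$ gives the bracket
$(\alpha+1)(1-|z|^2)/(1-z)-(\alpha+\beta+1)\bar z$. The identity $(1-|z|^2)/(1-z)=(1-\bar
z)/(1-z)+\bar z$ brings it to the form in `kernelZ`, and $\partial_{\bar z}$ is symmetric. -/
theorem hasFDerivAt_poissonKernel (α β : ℝ) {z : ℂ} (hz : ‖z‖ < 1) :
    HasFDerivAt (poissonKernel α β)
      (kernelZ α β z • ContinuousLinearMap.id ℝ ℂ +
        kernelZbar α β z • (Complex.conjCLE : ℂ →L[ℝ] ℂ)) z := by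
  have h1 := one_sub_mem_slitPlane hz
  have h2 := one_sub_conj_mem_slitPlane hz
  have h3 := one_sub_norm_sq_pos hz
  have n1 := Complex.slitPlane_ne_zero h1
  have n2 := Complex.slitPlane_ne_zero h2
  have e1 : HasFDerivAt (fun z : ℂ => (1 - z) ^ (-((α + 1 : ℝ) : ℂ)))
      ((((α + 1 : ℝ) : ℂ) * (1 - z) ^ (-((α + 1 : ℝ) : ℂ)) / (1 - z)) •
        ContinuousLinearMap.id ℝ ℂ) z := by
    have := (((hasDerivAt_id z).const_sub 1).cpow_const (c := -((α + 1 : ℝ) : ℂ)) h1)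
    refine (this.hasFDerivAt.restrictScalars ℝ).congr_fderiv ?_
    ext v
    simp only [id, Complex.cpow_sub _ _ n1, Complex.cpow_one, ContinuousLinearMap.coe_restrictScalars',
      ContinuousLinearMap.toSpanSingleton_apply, smul_apply,
      ContinuousLinearMap.id_apply, smul_eq_mul]
    ring
  have e2 : HasFDerivAt (fun z : ℂ => (1 - conj z) ^ (-((β + 1 : ℝ) : ℂ)))
      ((((β + 1 : ℝ) : ℂ) * (1 - conj z) ^ (-((β + 1 : ℝ) : ℂ)) / (1 - conj z)) •
        (Complex.conjCLE : ℂ →L[ℝ] ℂ)) z := by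
    have := (((hasDerivAt_id (conj z)).const_sub 1).cpow_const (c := -((β + 1 : ℝ) : ℂ)) h2)
    have h := (this.hasFDerivAt.restrictScalars ℝ).comp z (Complex.conjCLE : ℂ →L[ℝ] ℂ).hasFDerivAt
    refine h.congr_fderiv ?_
    ext v
    simp only [id, Complex.cpow_sub _ _ n2, Complex.cpow_one, ContinuousLinearMap.coe_restrictScalars',
      ContinuousLinearMap.toSpanSingleton_apply, smul_apply,
      ContinuousLinearMap.comp_apply, smul_eq_mul]
    ring
  have e3 : HasFDerivAt (fun z : ℂ => (((1 - ‖z‖ ^ 2) ^ (α + β + 1) : ℝ) : ℂ))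
      ((-(((α + β + 1) * (1 - ‖z‖ ^ 2) ^ (α + β) : ℝ) : ℂ)) •
        (conj z • ContinuousLinearMap.id ℝ ℂ + z • (Complex.conjCLE : ℂ →L[ℝ] ℂ))) z := by
    have hn : HasFDerivAt (fun z : ℂ => ‖z‖ ^ 2) (2 • (innerSL ℝ z)) z :=
      (hasStrictFDerivAt_norm_sq z).hasFDerivAt
    have := ((hn.const_sub 1).rpow_const (p := α + β + 1) (Or.inl h3.ne'))
    refine (Complex.ofRealCLM.hasFDerivAt.comp z this).congr_fderiv ?_
    ext v
    have hin : ((inner ℝ z v : ℝ) : ℂ) * 2 = conj z * v + z * conj v := by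
      rw [Complex.inner]
      apply Complex.ext <;> simp <;> ring
    simp only [ContinuousLinearMap.comp_apply, smul_apply,
      neg_apply, innerSL_apply_apply, add_apply,
      ContinuousLinearMap.id_apply, smul_eq_mul, Complex.ofRealCLM_apply, nsmul_eq_mul,
      ContinuousLinearEquiv.coe_coe, Complex.conjCLE_apply, add_sub_cancel_right, ← hin]
    push_cast
    ring
  have e := ((e3.const_mul (normConst α β : ℂ)).mul e1).mul e2
  have hP : poissonKernel α β = ((fun y : ℂ => (normConst α β : ℂ) *
      (((1 - ‖y‖ ^ 2) ^ (α + β + 1) : ℝ) : ℂ)) * fun z : ℂ => (1 - z) ^ (-((α + 1 : ℝ) : ℂ))) *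
      fun z : ℂ => (1 - conj z) ^ (-((β + 1 : ℝ) : ℂ)) := by
    ext w
    simp only [poissonKernel, Pi.mul_apply, Complex.cpow_neg, div_eq_mul_inv, mul_inv]
    ring
  rw [hP]
  refine e.congr_fderiv ?_
  ext v
  -- One factor $1-|z|^2=1-z\bar z$ is split off, so that every term contains `coreKernel`.
  have hX : (((1 - ‖z‖ ^ 2) ^ (α + β + 1) : ℝ) : ℂ) =
      (((1 - ‖z‖ ^ 2) ^ (α + β) : ℝ) : ℂ) * (1 - z * conj z) := by
    rw [Real.rpow_add_one h3.ne', Complex.ofReal_mul, Complex.mul_conj, Complex.normSq_eq_norm_sq]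
    push_cast
    ring
  simp only [smul_apply, add_apply,
      ContinuousLinearMap.id_apply, smul_eq_mul, Pi.mul_apply, kernelZ, kernelZbar, coreKernel, hX,
      ContinuousLinearEquiv.coe_coe, Complex.conjCLE_apply, Complex.cpow_neg,
      Complex.ofReal_mul, Complex.ofReal_add, Complex.ofReal_one]
  have n3 : (1 - z) ^ ((α : ℂ) + 1) ≠ 0 := by simp [Complex.cpow_eq_zero_iff, n1]
  have n4 : (1 - conj z) ^ ((β : ℂ) + 1) ≠ 0 := by simp [Complex.cpow_eq_zero_iff, n2]
  field_simp
  ring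

/-! ### Joint continuity in the parameters and the point -/

/-- Admissibility keeps $\alpha+1$ and $\beta+1$ away from the poles of $\Gamma$ and makes
$\alpha+\beta+1$ positive. -/
theorem continuousOn_normConst :
    ContinuousOn (fun x : ℝ × ℝ => normConst x.1 x.2) {x | Admissible x.1 x.2} := by
  intro x hx
  have hG : ∀ s : ℝ, (∀ n : ℕ, s ≠ -((n : ℝ) + 1)) → ContinuousAt Real.Gamma (s + 1) := by
    intro s hs
    refine (Real.differentiableAt_Gamma fun n hn => ?_).continuousAt
    exact hs n (by linarith)
  have h3 : ContinuousAt Real.Gamma (x.1 + x.2 + 1) := by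
    refine (Real.differentiableAt_Gamma fun n hn => ?_).continuousAt
    have := hx.sum
    have : (0 : ℝ) ≤ n := n.cast_nonneg
    linarith
  have h4 : Real.Gamma (x.1 + x.2 + 1) ≠ 0 := (Real.Gamma_pos_of_pos (by linarith [hx.sum])).ne'
  refine ContinuousAt.continuousWithinAt ?_
  refine ContinuousAt.div (ContinuousAt.mul ?_ ?_) ?_ h4
  · exact ContinuousAt.comp' (hG x.1 hx.left) (by fun_prop)
  · exact ContinuousAt.comp' (hG x.2 hx.right) (by fun_prop)
  · exact ContinuousAt.comp' (f := fun x : ℝ × ℝ => x.1 + x.2 + 1) h3 (by fun_prop)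

theorem normConst_ne_zero {α β : ℝ} (h : Admissible α β) : normConst α β ≠ 0 := by
  refine div_ne_zero (mul_ne_zero ?_ ?_) (Real.Gamma_pos_of_pos (by linarith [h.sum])).ne'
  · exact Real.Gamma_ne_zero fun n hn => h.left n (by linarith)
  · exact Real.Gamma_ne_zero fun n hn => h.right n (by linarith)

theorem continuousOn_coreKernel :
    ContinuousOn (fun x : (ℝ × ℝ) × ℂ => coreKernel x.1.1 x.1.2 x.2)
      {x | Admissible x.1.1 x.1.2 ∧ ‖x.2‖ < 1} := by
  unfold coreKernel
  refine ContinuousOn.div (ContinuousOn.mul ?_ ?_) (ContinuousOn.mul ?_ ?_) ?_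
  · exact Complex.continuous_ofReal.comp_continuousOn
      (continuousOn_normConst.comp continuousOn_fst fun x hx => hx.1)
  · refine Complex.continuous_ofReal.comp_continuousOn
      (ContinuousOn.rpow (by fun_prop) (by fun_prop) fun x hx => Or.inl ?_)
    exact (one_sub_norm_sq_pos hx.2).ne'
  · exact ContinuousOn.cpow (by fun_prop) (by fun_prop) fun x hx => one_sub_mem_slitPlane hx.2
  · refine ContinuousOn.cpow ?_ (by fun_prop) fun x hx => one_sub_conj_mem_slitPlane hx.2
    exact (continuous_const.sub (Complex.continuous_conj.comp continuous_snd)).continuousOn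
  · intro x hx
    have n1 := Complex.slitPlane_ne_zero (one_sub_mem_slitPlane hx.2)
    have n2 := Complex.slitPlane_ne_zero (one_sub_conj_mem_slitPlane hx.2)
    simp [Complex.cpow_eq_zero_iff, n1, n2]

theorem continuousOn_kernelZ :
    ContinuousOn (fun x : (ℝ × ℝ) × ℂ => kernelZ x.1.1 x.1.2 x.2)
      {x | Admissible x.1.1 x.1.2 ∧ ‖x.2‖ < 1} := by
  have hc : Continuous fun x : (ℝ × ℝ) × ℂ => conj x.2 := Complex.continuous_conj.comp continuous_snd
  have h1 : Continuous fun x : (ℝ × ℝ) × ℂ => (x.1.1 : ℂ) := by fun_prop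
  have h2 : Continuous fun x : (ℝ × ℝ) × ℂ => (x.1.2 : ℂ) := by fun_prop
  refine continuousOn_coreKernel.mul (ContinuousOn.sub (ContinuousOn.div ?_ ?_ ?_) ?_)
  · exact ((h1.add continuous_const).mul (continuous_const.sub hc)).continuousOn
  · fun_prop
  · exact fun x hx => Complex.slitPlane_ne_zero (one_sub_mem_slitPlane hx.2)
  · exact (h2.mul hc).continuousOn

theorem continuousOn_kernelZbar :
    ContinuousOn (fun x : (ℝ × ℝ) × ℂ => kernelZbar x.1.1 x.1.2 x.2)
      {x | Admissible x.1.1 x.1.2 ∧ ‖x.2‖ < 1} := by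
  have hc : Continuous fun x : (ℝ × ℝ) × ℂ => conj x.2 := Complex.continuous_conj.comp continuous_snd
  have h1 : Continuous fun x : (ℝ × ℝ) × ℂ => (x.1.1 : ℂ) := by fun_prop
  have h2 : Continuous fun x : (ℝ × ℝ) × ℂ => (x.1.2 : ℂ) := by fun_prop
  refine continuousOn_coreKernel.mul (ContinuousOn.sub (ContinuousOn.div ?_ ?_ ?_) ?_)
  · exact ((h2.add continuous_const).mul (by fun_prop)).continuousOn
  · exact (continuous_const.sub hc).continuousOn
  · exact fun x hx => Complex.slitPlane_ne_zero (one_sub_conj_mem_slitPlane hx.2)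
  · exact (h1.mul (by fun_prop)).continuousOn

/-! ### Derivatives of the Poisson integral as convolutions on the circle -/

/-- The point `e^{iτ}` of the unit circle as a complex number. -/
def unit (τ : T) : ℂ := (AddCircle.toCircle τ : Circle)

theorem continuous_unit : Continuous unit :=
  continuous_subtype_val.comp AddCircle.continuous_toCircle

theorem norm_unit (τ : T) : ‖unit τ‖ = 1 := Circle.norm_coe _

theorem unit_coe (θ : ℝ) : unit (θ : T) = Complex.exp (θ * Complex.I) := by
  rw [unit, AddCircle.toCircle_apply_mk, Circle.coe_exp]
  simp

theorem unit_sub (s t : T) : unit (s - t) = unit s * conj (unit t) := by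
  simp only [unit, sub_eq_add_neg, AddCircle.toCircle_add, AddCircle.toCircle_neg, Circle.coe_mul,
    Circle.coe_inv_eq_conj]

theorem unit_mul_conj (τ : T) : unit τ * conj (unit τ) = 1 := by
  rw [Complex.mul_conj, Complex.normSq_eq_norm_sq, norm_unit]
  simp

theorem polar_eq (r θ : ℝ) : polar r θ = r * unit (θ : T) := by rw [unit_coe, polar]

/-- The kernel `x e^{iτ} P_z + y e^{-iτ} P_z̄` at `r e^{iτ}`. -/
def polarKernel (α β r : ℝ) (x y : ℂ) (τ : T) : ℂ :=
  x * (unit τ * kernelZ α β (r * unit τ)) + y * (conj (unit τ) * kernelZbar α β (r * unit τ))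

theorem norm_mul_unit_lt {r : ℝ} (hr : 0 ≤ r) (hr1 : r < 1) (τ : T) : ‖(r : ℂ) * unit τ‖ < 1 := by
  simpa [norm_unit, abs_of_nonneg hr] using hr1

/-- Continuity in $(\alpha,\beta)$ as well as in $\tau$ is what the passage $(\alpha,\beta)\to(0,0)$
in `continuousAt_polarIntegral` rests on. -/
theorem continuousOn_polarKernel {r : ℝ} (hr : 0 ≤ r) (hr1 : r < 1) (x y : ℂ) :
    ContinuousOn (fun w : (ℝ × ℝ) × T => polarKernel w.1.1 w.1.2 r x y w.2)
      {w | Admissible w.1.1 w.1.2} := by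
  have hu : Continuous fun w : (ℝ × ℝ) × T => unit w.2 := continuous_unit.comp continuous_snd
  have hm : Continuous fun w : (ℝ × ℝ) × T => (w.1, (r : ℂ) * unit w.2) :=
    continuous_fst.prodMk (continuous_const.mul hu)
  have h1 := continuousOn_kernelZ.comp hm.continuousOn (s := {w : (ℝ × ℝ) × T | Admissible w.1.1 w.1.2})
    fun w hw => ⟨hw, norm_mul_unit_lt hr hr1 _⟩
  have h2 := continuousOn_kernelZbar.comp hm.continuousOn (s := {w : (ℝ × ℝ) × T | Admissible w.1.1 w.1.2})
    fun w hw => ⟨hw, norm_mul_unit_lt hr hr1 _⟩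
  exact (continuousOn_const.mul (hu.continuousOn.mul h1)).add
    (continuousOn_const.mul ((Complex.continuous_conj.comp hu).continuousOn.mul h2))

theorem continuous_polarKernel {α β r : ℝ} (h : Admissible α β) (hr : 0 ≤ r) (hr1 : r < 1)
    (x y : ℂ) : Continuous (polarKernel α β r x y) := by
  rw [← continuousOn_univ]
  exact (continuousOn_polarKernel hr hr1 x y).comp (f := fun τ : T => ((α, β), τ))
    (by fun_prop) fun τ _ => h

theorem integrable_polarKernel_mul {α β r : ℝ} (h : Admissible α β) (hr : 0 ≤ r) (hr1 : r < 1)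
    (x y : ℂ) (τ : T) {f : T → ℂ} (hf : Integrable f m) :
    Integrable (fun t => polarKernel α β r x y (τ - t) * f t) m := by
  have hc : Continuous fun t => polarKernel α β r x y (τ - t) :=
    (continuous_polarKernel h hr hr1 x y).comp (by fun_prop)
  obtain ⟨M, hM⟩ := isCompact_univ.exists_bound_of_continuousOn hc.continuousOn
  exact hf.bdd_mul hc.aestronglyMeasurable (Eventually.of_forall fun t => hM t (mem_univ t))

/-- Differentiation under the integral sign. For $|w|<\rho<1$ all points $w\bar\zeta$ lie in the
compact disk of radius $\rho$, where both kernel derivatives are bounded, so a multiple of $|f|$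
dominates and integrability of $f$ is enough. -/
theorem hasFDerivAt_poissonIntegral {α β : ℝ} (h : Admissible α β) {f : T → ℂ}
    (hf : Integrable f m) {z : ℂ} (hz : ‖z‖ < 1) :
    ∃ L : ℂ →L[ℝ] ℂ, HasFDerivAt (poissonIntegral α β f) L z ∧ ∀ v : ℂ, L v =
      ∫ t, (kernelZ α β (z * conj (unit t)) * conj (unit t) * v +
        kernelZbar α β (z * conj (unit t)) * unit t * conj v) * f t ∂m := by
  obtain ⟨ρ, hzρ, hρ⟩ := exists_between hz
  have hcu : Continuous fun t => conj (unit t) := Complex.continuous_conj.comp continuous_unit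
  have hsub : Metric.closedBall (0 : ℂ) ρ ⊆ {w | ‖w‖ < 1} := fun w hw => by
    have : ‖w‖ ≤ ρ := by simpa using hw
    exact this.trans_lt hρ
  have hC1 : ContinuousOn (kernelZ α β) {w | ‖w‖ < 1} :=
    continuousOn_kernelZ.comp (f := fun w : ℂ => ((α, β), w)) (by fun_prop) fun w hw => ⟨h, hw⟩
  have hC2 : ContinuousOn (kernelZbar α β) {w | ‖w‖ < 1} :=
    continuousOn_kernelZbar.comp (f := fun w : ℂ => ((α, β), w)) (by fun_prop) fun w hw => ⟨h, hw⟩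
  have hC0 : ContinuousOn (poissonKernel α β) {w | ‖w‖ < 1} := fun w hw =>
    (hasFDerivAt_poissonKernel α β hw).continuousAt.continuousWithinAt
  obtain ⟨M1, hM1⟩ := (isCompact_closedBall (0 : ℂ) ρ).exists_bound_of_continuousOn (hC1.mono hsub)
  obtain ⟨M2, hM2⟩ := (isCompact_closedBall (0 : ℂ) ρ).exists_bound_of_continuousOn (hC2.mono hsub)
  obtain ⟨M0, hM0⟩ := (isCompact_closedBall (0 : ℂ) ρ).exists_bound_of_continuousOn (hC0.mono hsub)
  have hnorm : ∀ (w : ℂ) (t : T), ‖w * conj (unit t)‖ = ‖w‖ := fun w t => by simp [norm_unit]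
  have hmem : ∀ w ∈ Metric.ball (0 : ℂ) ρ, ∀ t, w * conj (unit t) ∈ Metric.closedBall (0 : ℂ) ρ := by
    intro w hw t
    have : ‖w‖ < ρ := by simpa using hw
    simpa [norm_unit] using this.le
  have hcomp : ∀ {k : ℂ → ℂ}, ContinuousOn k {w | ‖w‖ < 1} → ∀ w ∈ Metric.ball (0 : ℂ) ρ,
      Continuous fun t => k (w * conj (unit t)) := by
    intro k hk w hw
    rw [← continuousOn_univ]
    exact hk.comp (continuous_const.mul hcu).continuousOn fun t _ => hsub (hmem w hw t)
  have hz' : z ∈ Metric.ball (0 : ℂ) ρ := by simpa using hzρ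
  set A : ℂ → T → ℂ := fun w t => kernelZ α β (w * conj (unit t)) * conj (unit t)
  set B : ℂ → T → ℂ := fun w t => kernelZbar α β (w * conj (unit t)) * unit t
  set F' : ℂ → T → ℂ →L[ℝ] ℂ := fun w t => (A w t * f t) • ContinuousLinearMap.id ℝ ℂ +
    (B w t * f t) • (Complex.conjCLE : ℂ →L[ℝ] ℂ) with hF'
  have hA : Continuous (A z) := (hcomp hC1 z hz').mul hcu
  have hB : Continuous (B z) := (hcomp hC2 z hz').mul continuous_unit
  have hnA : ∀ w ∈ Metric.ball (0 : ℂ) ρ, ∀ t, ‖A w t‖ ≤ M1 := fun w hw t => by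
    simpa [A, norm_unit] using hM1 _ (hmem w hw t)
  have hnB : ∀ w ∈ Metric.ball (0 : ℂ) ρ, ∀ t, ‖B w t‖ ≤ M2 := fun w hw t => by
    simpa [B, norm_unit] using hM2 _ (hmem w hw t)
  have hbd : ∀ w ∈ Metric.ball (0 : ℂ) ρ, ∀ t, ‖F' w t‖ ≤ (M1 + M2) * ‖f t‖ := by
    intro w hw t
    have hc1 : ‖(Complex.conjCLE : ℂ →L[ℝ] ℂ)‖ = 1 := Complex.conjCLE_norm
    have hc2 : ‖ContinuousLinearMap.id ℝ ℂ‖ = 1 := ContinuousLinearMap.norm_id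
    refine (norm_add_le _ _).trans ?_
    rw [norm_smul, norm_smul, hc1, hc2, mul_one, mul_one, norm_mul (A w t), norm_mul (B w t), add_mul]
    exact add_le_add (mul_le_mul_of_nonneg_right (hnA w hw t) (norm_nonneg _))
      (mul_le_mul_of_nonneg_right (hnB w hw t) (norm_nonneg _))
  have hF'm : AEStronglyMeasurable (F' z) m := by
    refine AEStronglyMeasurable.add ?_ ?_
    · exact (hA.aestronglyMeasurable.mul hf.1).smul_const _
    · exact (hB.aestronglyMeasurable.mul hf.1).smul_const _
  have hF'i : Integrable (F' z) m :=
    (hf.norm.const_mul (M1 + M2)).mono' hF'm (Eventually.of_forall fun t => hbd z hz' t)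
  refine ⟨∫ t, F' z t ∂m, ?_, fun v => ?_⟩
  · refine hasFDerivAt_integral_of_dominated_of_fderiv_le (F := fun w t =>
      poissonKernel α β (w * conj (unit t)) * f t) (bound := fun t => (M1 + M2) * ‖f t‖)
      (Metric.isOpen_ball.mem_nhds hz') ?_ ?_ hF'm
      (Eventually.of_forall fun t w hw => hbd w hw t) (hf.norm.const_mul _)
      (Eventually.of_forall fun t w hw => ?_)
    · filter_upwards [Metric.isOpen_ball.mem_nhds hz'] with w hw
      exact (hcomp hC0 w hw).aestronglyMeasurable.mul hf.1
    · exact hf.bdd_mul (hcomp hC0 z hz').aestronglyMeasurable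
        (Eventually.of_forall fun t => hM0 _ (hmem z hz' t))
    · have h1 := hasFDerivAt_poissonKernel α β (hsub (hmem w hw t))
      have h2 : HasFDerivAt (fun w : ℂ => w * conj (unit t))
          (conj (unit t) • ContinuousLinearMap.id ℝ ℂ) w :=
        (hasFDerivAt_id w).mul_const (conj (unit t))
      refine ((h1.comp w h2).mul_const (f t)).congr_fderiv ?_
      ext v
      simp only [hF', A, B, ContinuousLinearMap.comp_apply, smul_apply, add_apply,
        ContinuousLinearMap.id_apply, smul_eq_mul, ContinuousLinearEquiv.coe_coe,
        Complex.conjCLE_apply, map_mul, Complex.conj_conj]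
      ring
  · rw [ContinuousLinearMap.integral_apply hF'i]
    refine integral_congr_ae (Eventually.of_forall fun t => ?_)
    simp only [hF', A, B, smul_apply, add_apply, ContinuousLinearMap.id_apply, smul_eq_mul,
      ContinuousLinearEquiv.coe_coe, Complex.conjCLE_apply]
    ring

/-- The integral of `f` against the kernel `polarKernel`, rotated by `θ`. -/
def polarIntegral (α β : ℝ) (f : T → ℂ) (r θ : ℝ) (x y : ℂ) : ℂ :=
  ∫ t, polarKernel α β r x y ((θ : T) - t) * f t ∂m

theorem polarIntegral_add {α β r : ℝ} (h : Admissible α β) (hr : 0 ≤ r) (hr1 : r < 1)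
    {f : T → ℂ} (hf : Integrable f m) (θ : ℝ) (a b x y x' y' : ℂ) :
    a * polarIntegral α β f r θ x y + b * polarIntegral α β f r θ x' y' =
      polarIntegral α β f r θ (a * x + b * x') (a * y + b * y') := by
  simp only [polarIntegral]
  rw [← integral_const_mul, ← integral_const_mul, ← integral_add
    ((integrable_polarKernel_mul h hr hr1 x y _ hf).const_mul _)
    ((integrable_polarKernel_mul h hr hr1 x' y' _ hf).const_mul _)]
  refine integral_congr_ae (Eventually.of_forall fun t => ?_)
  simp only [polarKernel]
  ring

theorem differentiableAt_poissonIntegral {α β : ℝ} (h : Admissible α β) {f : T → ℂ}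
    (hf : Integrable f m) {z : ℂ} (hz : ‖z‖ < 1) :
    DifferentiableAt ℝ (poissonIntegral α β f) z := by
  obtain ⟨L, hL, -⟩ := hasFDerivAt_poissonIntegral h hf hz
  exact hL.differentiableAt

theorem norm_polar_lt {r : ℝ} (hr : 0 ≤ r) (hr1 : r < 1) (θ : ℝ) : ‖polar r θ‖ < 1 := by
  rw [polar_eq]
  exact norm_mul_unit_lt hr hr1 _

/-- In the rotated direction $e^{i\theta}v$ the unimodular factors combine with the kernel into a
function of $\theta-t$ alone. Then $v=1$ gives $u_r$, $v=ir$ gives $u_\theta$, and combinations of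
two directions give $u_z$ and $u_{\bar z}$. -/
theorem fderiv_poissonIntegral {α β r : ℝ} (h : Admissible α β) (hr : 0 ≤ r) (hr1 : r < 1)
    {f : T → ℂ} (hf : Integrable f m) (θ : ℝ) (v : ℂ) :
    fderiv ℝ (poissonIntegral α β f) (polar r θ) (unit (θ : T) * v) =
      polarIntegral α β f r θ v (conj v) := by
  obtain ⟨L, hL, hLv⟩ := hasFDerivAt_poissonIntegral h hf (norm_polar_lt hr hr1 θ)
  rw [hL.fderiv, hLv, polarIntegral]
  refine integral_congr_ae (Eventually.of_forall fun t => ?_)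
  simp only [polarKernel, polar_eq, unit_sub, map_mul, Complex.conj_conj, mul_assoc]
  ring

theorem dR_poissonIntegral {α β r : ℝ} (h : Admissible α β) (hr : 0 ≤ r) (hr1 : r < 1)
    {f : T → ℂ} (hf : Integrable f m) (θ : ℝ) :
    dR (poissonIntegral α β f) r θ = polarIntegral α β f r θ 1 1 := by
  have h1 := (differentiableAt_poissonIntegral h hf (norm_polar_lt hr hr1 θ)).hasFDerivAt
  have h2 : HasDerivAt (fun ρ : ℝ => polar ρ θ) (unit (θ : T) * 1) r := by
    have := (Complex.ofRealCLM.hasDerivAt (x := r)).mul_const (unit (θ : T))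
    simpa [polar_eq] using this
  have h3 := fderiv_poissonIntegral h hr hr1 hf θ 1
  rw [map_one] at h3
  rw [← h3]
  exact (h1.comp_hasDerivAt r h2).deriv

theorem dTheta_poissonIntegral {α β r : ℝ} (h : Admissible α β) (hr : 0 ≤ r) (hr1 : r < 1)
    {f : T → ℂ} (hf : Integrable f m) (θ : ℝ) :
    dTheta (poissonIntegral α β f) r θ =
      polarIntegral α β f r θ (Complex.I * r) (-(Complex.I * r)) := by
  have h1 := (differentiableAt_poissonIntegral h hf (norm_polar_lt hr hr1 θ)).hasFDerivAt
  have h2 : HasDerivAt (fun φ : ℝ => polar r φ) (unit (θ : T) * (Complex.I * r)) θ := by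
    have := (((Complex.ofRealCLM.hasDerivAt (x := θ)).mul_const Complex.I).cexp).const_mul (r : ℂ)
    rw [unit_coe]
    refine HasDerivAt.congr_deriv (f := fun φ : ℝ => polar r φ) this ?_
    simp only [Complex.ofRealCLM_apply, Complex.ofReal_one, one_mul]
    ring
  have h3 := fderiv_poissonIntegral h hr hr1 hf θ (Complex.I * r)
  rw [map_mul conj, Complex.conj_I, Complex.conj_ofReal, neg_mul] at h3
  rw [← h3]
  exact (h1.comp_hasDerivAt θ h2).deriv

theorem dZ_poissonIntegral {α β r : ℝ} (h : Admissible α β) (hr : 0 ≤ r) (hr1 : r < 1)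
    {f : T → ℂ} (hf : Integrable f m) (θ : ℝ) :
    dZ (poissonIntegral α β f) (polar r θ) =
      polarIntegral α β f r θ (conj (unit (θ : T))) 0 := by
  -- The factor $e^{-i\theta}$ cancels the rotation, so these are the derivatives in the directions
  -- $1$ and $i$. The coefficients $\tfrac12$ and $-\tfrac i2$ below then remove the $\partial_{\bar
  -- z}$ part.
  have h1 := fderiv_poissonIntegral h hr hr1 hf θ (conj (unit (θ : T)))
  have h2 := fderiv_poissonIntegral h hr hr1 hf θ (conj (unit (θ : T)) * Complex.I)
  rw [← mul_assoc] at h2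
  simp only [unit_mul_conj, one_mul] at h1 h2
  rw [dZ, h1, h2]
  have h3 := polarIntegral_add h hr hr1 hf θ (1 / 2) (-Complex.I / 2) (conj (unit (θ : T)))
    (conj (conj (unit (θ : T)))) (conj (unit (θ : T)) * Complex.I)
    (conj (conj (unit (θ : T)) * Complex.I))
  have e1 : 1 / 2 * conj (unit (θ : T)) + -Complex.I / 2 * (conj (unit (θ : T)) * Complex.I) =
      conj (unit (θ : T)) := by
    linear_combination (-conj (unit (θ : T)) / 2) * Complex.I_mul_I
  have e2 : 1 / 2 * conj (conj (unit (θ : T))) +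
      -Complex.I / 2 * conj (conj (unit (θ : T)) * Complex.I) = 0 := by
    rw [map_mul, Complex.conj_conj, Complex.conj_I]
    linear_combination (unit (θ : T) / 2) * Complex.I_mul_I
  rw [e1, e2] at h3
  rw [← h3]
  ring

theorem dZbar_poissonIntegral {α β r : ℝ} (h : Admissible α β) (hr : 0 ≤ r) (hr1 : r < 1)
    {f : T → ℂ} (hf : Integrable f m) (θ : ℝ) :
    dZbar (poissonIntegral α β f) (polar r θ) = polarIntegral α β f r θ 0 (unit (θ : T)) := by
  have h1 := fderiv_poissonIntegral h hr hr1 hf θ (conj (unit (θ : T)))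
  have h2 := fderiv_poissonIntegral h hr hr1 hf θ (conj (unit (θ : T)) * Complex.I)
  rw [← mul_assoc] at h2
  simp only [unit_mul_conj, one_mul] at h1 h2
  rw [dZbar, h1, h2]
  have h3 := polarIntegral_add h hr hr1 hf θ (1 / 2) (Complex.I / 2) (conj (unit (θ : T)))
    (conj (conj (unit (θ : T)))) (conj (unit (θ : T)) * Complex.I)
    (conj (conj (unit (θ : T)) * Complex.I))
  have e1 : 1 / 2 * conj (unit (θ : T)) + Complex.I / 2 * (conj (unit (θ : T)) * Complex.I) =
      0 := by
    linear_combination (conj (unit (θ : T)) / 2) * Complex.I_mul_I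
  have e2 : 1 / 2 * conj (conj (unit (θ : T))) +
      Complex.I / 2 * conj (conj (unit (θ : T)) * Complex.I) = unit (θ : T) := by
    rw [map_mul, Complex.conj_conj, Complex.conj_I]
    linear_combination (-unit (θ : T) / 2) * Complex.I_mul_I
  rw [e1, e2] at h3
  rw [← h3]
  ring

/-! ### The Möbius substitution -/

/-- The square of the distance from `-1` to `r e^{is}`. -/
def distSq (r s : ℝ) : ℝ := 1 + r ^ 2 + 2 * r * Real.cos s

/-- The angle `t` for which `e^{it} = (e^{is} + r) / (1 + r e^{is})`. -/
def moebiusAngle (r s : ℝ) : ℝ := s - 2 * (1 + (r : ℂ) * unit (s : T)).arg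

theorem one_add_mem_slitPlane {r : ℝ} (hr : 0 ≤ r) (hr1 : r < 1) (τ : T) :
    1 + (r : ℂ) * unit τ ∈ Complex.slitPlane := by
  have := one_sub_mem_slitPlane (z := -((r : ℂ) * unit τ))
    (by rw [norm_neg]; exact norm_mul_unit_lt hr hr1 τ)
  rwa [sub_neg_eq_add] at this

theorem normSq_one_add (r s : ℝ) :
    Complex.normSq (1 + (r : ℂ) * unit (s : T)) = distSq r s := by
  rw [unit_coe, Complex.normSq_apply, distSq]
  simp only [Complex.add_re, Complex.one_re, Complex.mul_re, Complex.ofReal_re, Complex.ofReal_im,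
    Complex.exp_ofReal_mul_I_re, Complex.exp_ofReal_mul_I_im, Complex.add_im, Complex.one_im,
    Complex.mul_im]
  nlinarith [Real.sin_sq_add_cos_sq s]

theorem distSq_pos {r : ℝ} (hr : 0 ≤ r) (hr1 : r < 1) (s : ℝ) : 0 < distSq r s := by
  rw [← normSq_one_add, Complex.normSq_pos]
  exact Complex.slitPlane_ne_zero (one_add_mem_slitPlane hr hr1 _)

theorem conj_unit_eq_inv (τ : T) : conj (unit τ) = (unit τ)⁻¹ :=
  eq_inv_of_mul_eq_one_right (unit_mul_conj τ)

/-- With $w=1+re^{is}$ the numerator is $e^{is}+r=e^{is}\bar w$, and $\bar w/w=e^{-2i\arg w}$. Since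
$w$ has positive real part, its principal argument has no jumps, and `moebiusAngle` is a smooth real
lift of the circle map. -/
theorem unit_moebiusAngle {r : ℝ} (hr : 0 ≤ r) (hr1 : r < 1) (s : ℝ) :
    unit (moebiusAngle r s : T) = (unit (s : T) + r) / (1 + r * unit (s : T)) := by
  set q : ℂ := 1 + (r : ℂ) * unit (s : T) with hq
  have hq0 : q ≠ 0 := Complex.slitPlane_ne_zero (one_add_mem_slitPlane hr hr1 _)
  have h1 : unit (s : T) + r = unit (s : T) * conj q := by
    simp only [hq, map_add, map_one, map_mul, Complex.conj_ofReal]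
    linear_combination (-(r : ℂ)) * unit_mul_conj (s : T)
  have h2 : q = ‖q‖ * Complex.exp (q.arg * Complex.I) := (Complex.norm_mul_exp_arg_mul_I q).symm
  have h3 : conj q = ‖q‖ * Complex.exp (-(q.arg * Complex.I)) := by
    conv_lhs => rw [h2]
    rw [map_mul, Complex.conj_ofReal, ← Complex.exp_conj]
    simp
  have hn : (‖q‖ : ℂ) ≠ 0 := by simpa using hq0
  rw [h1, eq_div_iff hq0, h3, moebiusAngle, ← hq]
  have h4 : unit ((s - 2 * q.arg : ℝ) : T) * Complex.exp (q.arg * Complex.I) =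
      unit (s : T) * Complex.exp (-(q.arg * Complex.I)) := by
    rw [unit_coe, unit_coe, ← Complex.exp_add, ← Complex.exp_add]
    congr 1
    push_cast
    ring
  calc unit ((s - 2 * q.arg : ℝ) : T) * q
      = unit ((s - 2 * q.arg : ℝ) : T) * (‖q‖ * Complex.exp (q.arg * Complex.I)) := by rw [← h2]
    _ = unit (s : T) * (‖q‖ * Complex.exp (-(q.arg * Complex.I))) := by
      rw [mul_left_comm, h4, mul_left_comm]

theorem hasDerivAt_moebiusAngle {r : ℝ} (hr : 0 ≤ r) (hr1 : r < 1) (s : ℝ) :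
    HasDerivAt (moebiusAngle r) ((1 - r ^ 2) / distSq r s) s := by
  have hu : HasDerivAt (fun s : ℝ => 1 + (r : ℂ) * unit (s : T))
      (r * (unit (s : T) * Complex.I)) s := by
    simp only [unit_coe]
    have := ((((Complex.ofRealCLM.hasDerivAt (x := s)).mul_const Complex.I).cexp).const_mul
      (r : ℂ)).const_add 1
    refine this.congr_deriv ?_
    simp
  have hl := hu.clog_real (one_add_mem_slitPlane hr hr1 _)
  have hi := Complex.imCLM.hasFDerivAt.comp_hasDerivAt s hl
  have h := (hasDerivAt_id s).sub (hi.const_mul 2)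
  have hd := distSq_pos hr hr1 s
  -- The argument is differentiated as the imaginary part of the principal logarithm.
  have hfun : moebiusAngle r =
      id - fun y => 2 * (Complex.imCLM ∘ fun t : ℝ => Complex.log (1 + (r : ℂ) * unit (t : T))) y := by
    ext y
    simp [moebiusAngle, Complex.log_im]
  rw [hfun]
  refine h.congr_deriv ?_
  rw [Complex.imCLM_apply, Complex.div_im, normSq_one_add, unit_coe]
  simp only [Complex.add_re, Complex.one_re, Complex.mul_re, Complex.ofReal_re, Complex.ofReal_im,
    Complex.exp_ofReal_mul_I_re, Complex.exp_ofReal_mul_I_im, Complex.add_im, Complex.one_im,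
    Complex.mul_im, Complex.I_re, Complex.I_im]
  field_simp
  rw [distSq]
  nlinarith [Real.sin_sq_add_cos_sq s]

theorem continuous_moebiusAngle {r : ℝ} (hr : 0 ≤ r) (hr1 : r < 1) :
    Continuous (moebiusAngle r) :=
  continuous_iff_continuousAt.2 fun s => (hasDerivAt_moebiusAngle hr hr1 s).continuousAt

theorem moebiusAngle_zero {r : ℝ} (hr : 0 ≤ r) : moebiusAngle r 0 = 0 := by
  rw [moebiusAngle, unit_coe]
  have : (1 + (r : ℂ) * Complex.exp (((0 : ℝ) : ℂ) * Complex.I)) = ((1 + r : ℝ) : ℂ) := by simp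
  rw [this, Complex.arg_ofReal_of_nonneg (by linarith)]
  simp

theorem moebiusAngle_two_pi {r : ℝ} (hr : 0 ≤ r) : moebiusAngle r (2 * π) = 2 * π := by
  have h := moebiusAngle_zero hr
  have h1 : ((2 * π : ℝ) : T) = ((0 : ℝ) : T) := by simp
  rw [moebiusAngle] at h ⊢
  rw [h1]
  linarith

/-- The lift is continuous and fixes $0$ and $2\pi$, so the intermediate value theorem applies. For
$p=1$ this lets the supremum over $s$ control the kernel on the whole circle. -/
theorem exists_moebiusAngle_eq {r : ℝ} (hr : 0 ≤ r) (hr1 : r < 1) (τ : T) :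
    ∃ s : ℝ, (moebiusAngle r s : T) = τ := by
  have h1 : τ ∈ (QuotientAddGroup.mk : ℝ → T) '' Icc 0 (0 + 2 * π) := by
    rw [AddCircle.coe_image_Icc_eq]
    exact mem_univ τ
  obtain ⟨t, ht, rfl⟩ := h1
  have h2 := intermediate_value_Icc (f := moebiusAngle r) Real.two_pi_pos.le
    (continuous_moebiusAngle hr hr1).continuousOn
  rw [moebiusAngle_zero hr, moebiusAngle_two_pi hr] at h2
  obtain ⟨s, -, hs⟩ := h2 (by simpa using ht)
  exact ⟨s, by rw [hs]⟩

/-- The trigonometric polynomial to which the bracket in `polarKernel` reduces after the change of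
variables `t = moebiusAngle r s`. -/
def trigPoly (α β r : ℝ) (x y : ℂ) (s : ℝ) : ℂ :=
  x * ((α + 1) * unit (s : T) - β * r) + y * ((β + 1) * conj (unit (s : T)) - α * r)

theorem continuous_trigPoly (α β r : ℝ) (x y : ℂ) : Continuous (trigPoly α β r x y) := by
  have hu : Continuous fun s : ℝ => unit (s : T) :=
    continuous_unit.comp (AddCircle.continuous_mk' _)
  have hc : Continuous fun s : ℝ => conj (unit (s : T)) := Complex.continuous_conj.comp hu
  unfold trigPoly
  fun_prop

theorem norm_coreKernel (α β : ℝ) {z : ℂ} (hz : ‖z‖ < 1) :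
    ‖coreKernel α β z‖ = |normConst α β| * (1 - ‖z‖ ^ 2) ^ (α + β) / ‖1 - z‖ ^ (α + β + 2) := by
  have h1 := one_sub_norm_sq_pos hz
  have h2 : 0 < ‖1 - z‖ := norm_pos_iff.2 (Complex.slitPlane_ne_zero (one_sub_mem_slitPlane hz))
  have h3 : ‖1 - conj z‖ = ‖1 - z‖ := by
    rw [← Complex.norm_conj (1 - z), map_sub, map_one]
  rw [coreKernel, norm_div, norm_mul, norm_mul, Complex.norm_cpow_real, Complex.norm_cpow_real, h3,
    ← Real.rpow_add h2, Complex.norm_real, Complex.norm_real, Real.norm_eq_abs,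
    Real.norm_eq_abs ((1 - ‖z‖ ^ 2) ^ (α + β)), abs_of_nonneg (Real.rpow_nonneg h1.le _)]
  congr 2
  ring

/-- The central computation. With $e=e^{it}$ and $E=e^{is}$ one has $1-re=(1-r^2)/(1+rE)$ and
$1-r\bar e=(1-r^2)E/(E+r)$, hence $e(1-r\bar e)/(1-re)=E$ and the bracket becomes $(\alpha+1)E-\beta
r$. In the modulus of the core factor the exponent of $1-r^2$ is
$(\alpha+\beta)-(\alpha+\beta+2)=-2$, whatever the parameters. -/
theorem norm_polarKernel_moebiusAngle (α β : ℝ) {r : ℝ} (hr : 0 ≤ r) (hr1 : r < 1) (x y : ℂ)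
    (s : ℝ) : ‖polarKernel α β r x y (moebiusAngle r s : T)‖ =
      |normConst α β| * ‖trigPoly α β r x y s‖ * distSq r s ^ ((α + β + 2) / 2) /
        (1 - r ^ 2) ^ 2 := by
  set e := unit (moebiusAngle r s : T) with he
  set E := unit (s : T) with hE
  have hq0 : 1 + r * E ≠ 0 := Complex.slitPlane_ne_zero (one_add_mem_slitPlane hr hr1 _)
  have he' : e = (E + r) / (1 + r * E) := unit_moebiusAngle hr hr1 s
  have hE0 : E ≠ 0 := by
    rw [← norm_pos_iff, norm_unit]; exact one_pos
  have he0 : e ≠ 0 := by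
    rw [← norm_pos_iff, norm_unit]; exact one_pos
  have hR : 0 < 1 - r ^ 2 := by nlinarith
  have hRc : (1 - (r : ℂ) ^ 2) ≠ 0 := by exact_mod_cast hR.ne'
  have hEr : E + r ≠ 0 := by
    intro h0
    rw [h0, zero_div] at he'
    exact he0 he'
  have h1 : 1 - r * e = (1 - r ^ 2) / (1 + r * E) := by
    rw [he']
    field_simp
    ring
  have hce : conj e = (1 + r * E) / (E + r) := by
    rw [he, conj_unit_eq_inv, ← he, he', inv_div]
  have h2 : 1 - r * conj e = (1 - r ^ 2) * E / (E + r) := by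
    rw [hce]
    field_simp
    ring
  have hz : ‖(r : ℂ) * e‖ = r := by simp [he, norm_unit, abs_of_nonneg hr]
  have hzc : conj ((r : ℂ) * e) = r * conj e := by simp
  have hK : polarKernel α β r x y (moebiusAngle r s : T) =
      coreKernel α β (r * e) * trigPoly α β r x y s := by
    have k1 : e * ((α + 1) * (1 - r * conj e) / (1 - r * e) - β * (r * conj e)) =
        (α + 1) * E - β * r := by
      have hq1 : 1 + E * r ≠ 0 := by rwa [mul_comm]
      rw [h1, h2, hce, he']
      field_simp
    have k2 : conj e * ((β + 1) * (1 - r * e) / (1 - r * conj e) - α * (r * e)) =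
        (β + 1) * conj E - α * r := by
      rw [h1, h2, hce, he', hE, conj_unit_eq_inv, ← hE]
      field_simp
    rw [polarKernel, trigPoly, ← he, ← hE, kernelZ, kernelZbar, hzc, ← k1, ← k2]
    ring
  have hd := distSq_pos hr hr1 s
  have hn : ‖1 - r * e‖ = (1 - r ^ 2) / Real.sqrt (distSq r s) := by
    have k : ‖(1 : ℂ) - r ^ 2‖ = 1 - r ^ 2 := by
      rw [show (1 : ℂ) - r ^ 2 = ((1 - r ^ 2 : ℝ) : ℂ) by push_cast; rfl, Complex.norm_real,
        Real.norm_eq_abs, abs_of_pos hR]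
    rw [h1, norm_div, k, ← normSq_one_add, Complex.normSq_eq_norm_sq, Real.sqrt_sq (norm_nonneg _)]
  rw [hK, norm_mul, norm_coreKernel α β (norm_mul_unit_lt hr hr1 _), hz, hn, Real.div_rpow hR.le
    (Real.sqrt_nonneg _), Real.sqrt_eq_rpow, ← Real.rpow_mul hd.le,
    show α + β + 2 = α + β + (2 : ℕ) by norm_num, Real.rpow_add_natCast hR.ne']
  have e1 := (Real.rpow_pos_of_pos hR (α + β)).ne'
  have e2 := (Real.rpow_pos_of_pos hd ((α + β + (2 : ℕ)) / 2)).ne'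
  rw [show 1 / 2 * (α + β + ((2 : ℕ) : ℝ)) = (α + β + (2 : ℕ)) / 2 by ring]
  field_simp

theorem integral_circle_eq {E : Type*} [NormedAddCommGroup E] [NormedSpace ℝ E] (F : T → E) :
    ∫ τ, F τ ∂m = (1 / (2 * π)) • ∫ s in (0 : ℝ)..(2 * π), F (s : T) := by
  have := AddCircle.intervalIntegral_preimage (2 * π) 0 F
  rw [zero_add] at this
  rw [this, AddCircle.integral_haarAddCircle, one_div]

theorem integral_moebiusAngle {r : ℝ} (hr : 0 ≤ r) (hr1 : r < 1) {F : T → ℝ} (hF : Continuous F) :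
    ∫ τ, F τ ∂m = 1 / (2 * π) * ∫ s in (0 : ℝ)..(2 * π),
      F (moebiusAngle r s : T) * ((1 - r ^ 2) / distSq r s) := by
  have hd : Continuous fun s : ℝ => (1 - r ^ 2) / distSq r s := by
    refine continuous_const.div (by unfold distSq; fun_prop) fun s => (distSq_pos hr hr1 s).ne'
  have h := intervalIntegral.integral_comp_mul_deriv (a := 0) (b := 2 * π) (f := moebiusAngle r)
    (f' := fun s => (1 - r ^ 2) / distSq r s) (g := fun s : ℝ => F (s : T))
    (fun s _ => hasDerivAt_moebiusAngle hr hr1 s) hd.continuousOn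
    (hF.comp (AddCircle.continuous_mk' _))
  rw [moebiusAngle_zero hr, moebiusAngle_two_pi hr] at h
  rw [integral_circle_eq, smul_eq_mul, ← h]
  rfl

/-- The Jacobian contributes one factor $1-r^2$ and one factor `distSq r s` to the power $-1$. This
accounts for the exponents $1-2q$ and $(Aq-2)/2$. -/
theorem integral_norm_polarKernel_rpow {α β r : ℝ} (h : Admissible α β) (hr : 0 ≤ r) (hr1 : r < 1)
    (x y : ℂ) {q : ℝ} (hq : 0 ≤ q) :
    ∫ τ, ‖polarKernel α β r x y τ‖ ^ q ∂m =
      |normConst α β| ^ q * (1 - r ^ 2) ^ (1 - 2 * q) * (1 / (2 * π) * ∫ s in (0 : ℝ)..(2 * π),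
        ‖trigPoly α β r x y s‖ ^ q * distSq r s ^ (((α + β + 2) * q - 2) / 2)) := by
  have hR : 0 < 1 - r ^ 2 := by nlinarith
  rw [integral_moebiusAngle hr hr1 (F := fun τ => ‖polarKernel α β r x y τ‖ ^ q)
    ((continuous_polarKernel h hr hr1 x y).norm.rpow_const fun _ => Or.inr hq), mul_left_comm,
    ← intervalIntegral.integral_const_mul (|normConst α β| ^ q * (1 - r ^ 2) ^ (1 - 2 * q))]
  congr 1
  apply intervalIntegral.integral_congr
  intro s _
  have hd := distSq_pos hr hr1 s
  simp only
  rw [norm_polarKernel_moebiusAngle α β hr hr1, Real.div_rpow (by positivity) (by positivity),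
    Real.mul_rpow (by positivity) (by positivity), Real.mul_rpow (by positivity) (by positivity),
    ← Real.rpow_mul hd.le, show ((α + β + 2) * q - 2) / 2 = (α + β + 2) / 2 * q - 1 by ring,
    Real.rpow_sub_one hd.ne', Real.rpow_sub hR, Real.rpow_one, Real.rpow_mul hR.le]
  norm_num
  ring

/-! ### Duality on the circle: Hölder's inequality and its converse -/

theorem conjExp_holder {p : ℝ≥0∞} (hp : 1 ≤ p) (hp1 : p ≠ 1) :
    1 ≤ conjExp p ∧ 1 / conjExp p = 1 - (p⁻¹).toReal ∧
      ENNReal.HolderTriple (ENNReal.ofReal (conjExp p)) p 1 := by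
  have h1 : p⁻¹ < 1 := by
    rw [ENNReal.inv_lt_one]
    exact lt_of_le_of_ne hp hp1.symm
  have h2 : (p⁻¹).toReal < 1 := by
    rw [← ENNReal.toReal_one]
    exact (ENNReal.toReal_lt_toReal h1.ne_top ENNReal.one_ne_top).2 h1
  have h3 : 0 ≤ (p⁻¹).toReal := ENNReal.toReal_nonneg
  refine ⟨?_, ?_, ⟨?_⟩⟩
  · exact (one_le_inv₀ (by linarith)).2 (by linarith)
  · rw [conjExp, one_div, inv_inv]
  · rw [conjExp, ← ENNReal.ofReal_inv_of_pos (inv_pos.2 (by linarith)), inv_inv,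
      ENNReal.ofReal_sub _ h3, ENNReal.ofReal_toReal h1.ne_top, ENNReal.ofReal_one, inv_one]
    exact tsub_add_cancel_of_le h1.le

theorem norm_integral_mul_le {p : ℝ≥0∞} (hp : 1 ≤ p) (hp1 : p ≠ 1) {k f : T → ℂ}
    (hk : Continuous k) (hf : MemLp f p m) :
    ‖∫ t, k t * f t ∂m‖ ≤ (∫ t, ‖k t‖ ^ conjExp p ∂m) ^ (1 / conjExp p) * lpNorm p f := by
  obtain ⟨hq, -, hH⟩ := conjExp_holder hp hp1
  set q := conjExp p
  have hq0 : (0 : ℝ) < q := by linarith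
  have hkq : MemLp k (ENNReal.ofReal q) m := by
    obtain ⟨M, hM⟩ := isCompact_univ.exists_bound_of_continuousOn hk.continuousOn
    exact MemLp.of_bound hk.aestronglyMeasurable M (Eventually.of_forall fun t => hM t (mem_univ t))
  have h1 := eLpNorm_smul_le_mul_eLpNorm (p := ENNReal.ofReal q) (q := p) (r := 1) hf.1 hkq.1
  have h2 := hkq.eLpNorm_eq_integral_rpow_norm (by simpa using hq0) ENNReal.ofReal_ne_top
  rw [ENNReal.toReal_ofReal hq0.le] at h2
  have hint : ‖∫ t, k t * f t ∂m‖ ≤ (eLpNorm (k • f) 1 m).toReal := by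
    rw [eLpNorm_one_eq_lintegral_enorm]
    refine (norm_integral_le_lintegral_norm _).trans (le_of_eq ?_)
    congr 2
    ext t
    rw [ofReal_norm]
    rfl
  refine hint.trans ?_
  have h3 := ENNReal.toReal_mono (ENNReal.mul_ne_top hkq.eLpNorm_ne_top hf.eLpNorm_ne_top) h1
  rw [ENNReal.toReal_mul, h2, ENNReal.toReal_ofReal (by positivity), ← one_div] at h3
  exact h3

theorem norm_integral_mul_le_one {k f : T → ℂ} {M : ℝ} (hk : ∀ t, ‖k t‖ ≤ M) (hf : MemLp f 1 m) :
    ‖∫ t, k t * f t ∂m‖ ≤ M * lpNorm 1 f := by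
  have h1 : lpNorm 1 f = ∫ t, ‖f t‖ ∂m := by
    rw [lpNorm, eLpNorm_one_eq_lintegral_enorm, integral_norm_eq_lintegral_enorm hf.1]
  rw [h1, ← integral_const_mul]
  refine norm_integral_le_of_norm_le ((memLp_one_iff_integrable.1 hf).norm.const_mul M)
    (Eventually.of_forall fun t => ?_)
  rw [norm_mul]
  exact mul_le_mul_of_nonneg_right (hk t) (norm_nonneg _)

/-- The constant function $1$ has norm $1$, because the measure is a probability measure. -/
theorem nonneg_of_forall_norm_integral_le {p : ℝ≥0∞} (hp : 1 ≤ p) {k : T → ℂ} {K : ℝ}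
    (h : ∀ f : T → ℂ, MemLp f p m → ‖∫ t, k t * f t ∂m‖ ≤ K * lpNorm p f) : 0 ≤ K := by
  have h1 := (norm_nonneg _).trans (h (fun _ => 1) (memLp_const 1))
  have h2 : lpNorm p (fun _ : T => (1 : ℂ)) = 1 := by
    rw [lpNorm, eLpNorm_const _ (by positivity) (NeZero.ne _)]
    simp
  rwa [h2, mul_one] at h1

/-- Equality in Hölder's inequality holds for $f=\bar k|k|^{q-2}$. With $S=\int|k|^q$ this test
function gives $S\le K\,S^{1-1/q}$. -/
theorem rpow_integral_le_of_forall_norm_integral_le {p : ℝ≥0∞} (hp : 1 ≤ p) (hp1 : p ≠ 1)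
    {k : T → ℂ} (hk : Continuous k) {K : ℝ}
    (h : ∀ f : T → ℂ, MemLp f p m → ‖∫ t, k t * f t ∂m‖ ≤ K * lpNorm p f) :
    (∫ t, ‖k t‖ ^ conjExp p ∂m) ^ (1 / conjExp p) ≤ K := by
  have hK := nonneg_of_forall_norm_integral_le hp h
  obtain ⟨hq, hqp, -⟩ := conjExp_holder hp hp1
  set q := conjExp p
  have hq0 : (0 : ℝ) < q := by linarith
  obtain ⟨M, hM⟩ := isCompact_univ.exists_bound_of_continuousOn hk.continuousOn
  set f : T → ℂ := fun t => conj (k t) * ((‖k t‖ ^ (q - 2) : ℝ) : ℂ) with hf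
  set S := ∫ t, ‖k t‖ ^ q ∂m with hS
  have hS0 : 0 ≤ S := integral_nonneg fun t => by positivity
  have hkf : ∀ t, k t * f t = ((‖k t‖ ^ q : ℝ) : ℂ) := by
    intro t
    by_cases h0 : k t = 0
    · simp [h0, hf, Real.zero_rpow hq0.ne']
    · have hn : 0 < ‖k t‖ := norm_pos_iff.2 h0
      simp only [hf]
      rw [← mul_assoc, Complex.mul_conj, Complex.normSq_eq_norm_sq, ← Complex.ofReal_mul,
        ← Real.rpow_natCast, ← Real.rpow_add hn]
      norm_num
  have hnf : ∀ t, k t ≠ 0 → ‖f t‖ = ‖k t‖ ^ (q - 1) := by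
    intro t h0
    have hn : 0 < ‖k t‖ := norm_pos_iff.2 h0
    simp only [hf]
    rw [norm_mul, Complex.norm_conj, Complex.norm_real, Real.norm_eq_abs,
      abs_of_nonneg (by positivity), mul_comm, ← Real.rpow_add_one hn.ne']
    congr 1
    ring
  -- Only an inequality holds at the zeros of $k$: for $q=1$ the right side is $0^0=1$ there, while
  -- $f$ vanishes.
  have hfle : ∀ t, ‖f t‖ ≤ ‖k t‖ ^ (q - 1) := by
    intro t
    by_cases h0 : k t = 0
    · simp only [hf, h0, map_zero, zero_mul, norm_zero]
      positivity
    · exact (hnf t h0).le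
  have hfm : Measurable f := by
    refine (Complex.continuous_conj.comp hk).measurable.mul
      (Complex.measurable_ofReal.comp (hk.norm.measurable.pow_const _))
  have hfp : ∀ p', MemLp f p' m := fun p' =>
    MemLp.of_bound hfm.aestronglyMeasurable (M ^ (q - 1)) (Eventually.of_forall fun t =>
      (hfle t).trans (Real.rpow_le_rpow (norm_nonneg _) (hM t (mem_univ t)) (by linarith)))
  have hnorm : lpNorm p f ≤ S ^ (1 - 1 / q) := by
    by_cases hpt : p = ∞
    · have hq1 : q = 1 := by simp [q, conjExp, hpt]
      have : eLpNorm f p m ≤ ENNReal.ofReal 1 := by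
        rw [hpt, eLpNorm_exponent_top]
        refine eLpNormEssSup_le_of_ae_bound (Eventually.of_forall fun t => ?_)
        simpa [hq1] using hfle t
      have h2 := ENNReal.toReal_mono ENNReal.ofReal_ne_top this
      rw [hq1]
      simpa [lpNorm] using h2
    · have hp0 : p ≠ 0 := (zero_lt_one.trans_le hp).ne'
      have hpr : 0 < p.toReal := ENNReal.toReal_pos hp0 hpt
      rw [lpNorm, (hfp p).eLpNorm_eq_integral_rpow_norm hp0 hpt,
        ENNReal.toReal_ofReal (by positivity), hqp, sub_sub_cancel, ENNReal.toReal_inv]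
      have hq1 : 1 / q < 1 := by
        rw [hqp, ENNReal.toReal_inv]
        have := inv_pos.2 hpr
        linarith
      have hqlt : 1 < q := by
        rwa [div_lt_one hq0] at hq1
      have hmul : (q - 1) * p.toReal = q := by
        rw [ENNReal.toReal_inv] at hqp
        field_simp at hqp
        linarith
      refine le_of_eq ?_
      congr 1
      refine integral_congr_ae (Eventually.of_forall fun t => ?_)
      simp only
      by_cases h0 : k t = 0
      · simp [hf, h0, Real.zero_rpow hpr.ne', Real.zero_rpow hq0.ne']
      · rw [hnf t h0, ← Real.rpow_mul (norm_nonneg _), hmul]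
  have h1 := h f (hfp p)
  have h2 : ∫ t, k t * f t ∂m = (S : ℂ) := by
    rw [hS, ← integral_complex_ofReal]
    exact integral_congr_ae (Eventually.of_forall hkf)
  rw [h2, Complex.norm_real, Real.norm_eq_abs, abs_of_nonneg hS0] at h1
  have h3 := h1.trans (mul_le_mul_of_nonneg_left hnorm hK)
  -- Dividing $S\le K\,S^{1-1/q}$ requires $S>0$. If $S=0$ the claim is $0\le K$.
  rcases hS0.eq_or_lt with h0 | hpos
  · rw [← h0, Real.zero_rpow (by positivity)]
    exact hK
  · rw [Real.rpow_sub hpos, Real.rpow_one, mul_div_assoc', le_div_iff₀ (by positivity), mul_comm] at h3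
    exact le_of_mul_le_mul_right (by linarith [h3]) hpos

/-- If $K<c<|k(\tau)|$, then $\operatorname{Re}(k\,\overline{k(\tau)})>c\,|k(\tau)|$ on an open set
$U$ containing $\tau$, which has positive measure. Testing with $\overline{k(\tau)}\,1_U$
contradicts the bound. -/
theorem norm_le_of_forall_norm_integral_le {k : T → ℂ} (hk : Continuous k) {K : ℝ}
    (h : ∀ f : T → ℂ, MemLp f 1 m → ‖∫ t, k t * f t ∂m‖ ≤ K * lpNorm 1 f) (τ : T) :
    ‖k τ‖ ≤ K := by
  have hK := nonneg_of_forall_norm_integral_le le_rfl h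
  by_contra! hlt
  obtain ⟨c, hKc, hc⟩ := exists_between hlt
  have hpos : 0 < ‖k τ‖ := hK.trans_lt hlt
  have hg : Continuous fun t => (k t * conj (k τ)).re :=
    Complex.continuous_re.comp (hk.mul continuous_const)
  set U : Set T := {t | c * ‖k τ‖ < (k t * conj (k τ)).re} with hU
  have hUo : IsOpen U := isOpen_lt continuous_const hg
  have hτ : τ ∈ U := by
    change c * ‖k τ‖ < (k τ * conj (k τ)).re
    rw [Complex.mul_conj, Complex.ofReal_re, Complex.normSq_eq_norm_sq, sq]
    exact mul_lt_mul_of_pos_right hc hpos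
  have hmU : 0 < (m U).toReal :=
    ENNReal.toReal_pos (hUo.measure_pos _ ⟨τ, hτ⟩).ne' (measure_ne_top _ _)
  set f : T → ℂ := U.indicator fun _ => conj (k τ) with hf
  have hfL : MemLp f 1 m := (memLp_const _).indicator hUo.measurableSet
  have hfn : lpNorm 1 f = ‖k τ‖ * (m U).toReal := by
    rw [lpNorm, eLpNorm_indicator_const hUo.measurableSet one_ne_zero ENNReal.one_ne_top]
    simp
  have hki : Integrable (fun t => k t * conj (k τ)) m :=
    (hk.mul continuous_const).integrable_of_hasCompactSupport
      (HasCompactSupport.of_compactSpace _)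
  have h1 : ∫ t, k t * f t ∂m = ∫ t in U, k t * conj (k τ) ∂m := by
    rw [← integral_indicator hUo.measurableSet]
    refine integral_congr_ae (Eventually.of_forall fun t => ?_)
    by_cases ht : t ∈ U <;> simp [hf, ht]
  have h2 : c * ‖k τ‖ * (m U).toReal ≤ (∫ t, k t * f t ∂m).re := by
    rw [h1]
    have h3 : (∫ t in U, k t * conj (k τ) ∂m).re = ∫ t in U, (k t * conj (k τ)).re ∂m :=
      (integral_re hki.integrableOn).symm
    rw [h3, mul_comm, ← smul_eq_mul, ← measureReal_def, ← setIntegral_const]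
    refine setIntegral_mono_on (integrable_const _).integrableOn hki.re.integrableOn
      hUo.measurableSet fun t ht => ?_
    exact le_of_lt ht
  have h4 := (h2.trans (Complex.re_le_norm _)).trans (h f hfL)
  rw [hfn, mul_assoc] at h4
  have := le_of_mul_le_mul_right h4 (mul_pos hpos hmU)
  linarith

/-! ### The exact norm of the derivative functionals -/

open Classical in
/-- The norm of the functional `f ↦ polarIntegral α β f r θ x y` on `L^p`, multiplied by
`weight p r`. -/
def sharpConst (α β : ℝ) (p : ℝ≥0∞) (r : ℝ) (x y : ℂ) : ℝ :=
  if p = 1 then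
    |normConst α β| * ⨆ s : ℝ, ‖trigPoly α β r x y s‖ * distSq r s ^ ((α + β + 2) / 2)
  else
    |normConst α β| * (1 / (2 * π) * ∫ s in (0 : ℝ)..(2 * π), ‖trigPoly α β r x y s‖ ^ conjExp p *
      distSq r s ^ (((α + β + 2) * conjExp p - 2) / 2)) ^ (1 / conjExp p)

theorem weight_pos (p : ℝ≥0∞) {r : ℝ} (hr : 0 ≤ r) (hr1 : r < 1) : 0 < weight p r :=
  Real.rpow_pos_of_pos (by nlinarith) _

theorem rpow_integral_polarKernel {p : ℝ≥0∞} (hp : 1 ≤ p) (hp1 : p ≠ 1) {α β r : ℝ}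
    (h : Admissible α β) (hr : 0 ≤ r) (hr1 : r < 1) (x y : ℂ) :
    (∫ τ, ‖polarKernel α β r x y τ‖ ^ conjExp p ∂m) ^ (1 / conjExp p) =
      sharpConst α β p r x y / weight p r := by
  obtain ⟨hq, hqp, -⟩ := conjExp_holder hp hp1
  have hR : 0 < 1 - r ^ 2 := by nlinarith
  rw [integral_norm_polarKernel_rpow h hr hr1 x y (by linarith), sharpConst, if_neg hp1, weight]
  set q := conjExp p
  have hq0 : (0 : ℝ) < q := by linarith
  have hJ : 0 ≤ 1 / (2 * π) * ∫ s in (0 : ℝ)..(2 * π), ‖trigPoly α β r x y s‖ ^ q *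
      distSq r s ^ (((α + β + 2) * q - 2) / 2) := by
    refine mul_nonneg (by positivity) (intervalIntegral.integral_nonneg Real.two_pi_pos.le ?_)
    intro s _
    have := distSq_pos hr hr1 s
    positivity
  rw [Real.mul_rpow (by positivity) hJ, Real.mul_rpow (by positivity) (by positivity),
    ← Real.rpow_mul (abs_nonneg _), ← Real.rpow_mul hR.le, mul_one_div_cancel hq0.ne',
    Real.rpow_one]
  -- The $q$-th root of $(1-r^2)^{1-2q}$ is $(1-r^2)^{1/q-2}$, and $1/q=1-1/p$.
  have he : (1 - 2 * q) * (1 / q) = -(1 + (p⁻¹).toReal) := by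
    have : (p⁻¹).toReal = 1 - 1 / q := by linarith
    rw [this]
    field_simp
    ring
  rw [he, Real.rpow_neg hR.le]
  ring

theorem norm_polarKernel_one {α β r : ℝ} (hr : 0 ≤ r) (hr1 : r < 1)
    (x y : ℂ) (s : ℝ) : ‖polarKernel α β r x y (moebiusAngle r s : T)‖ =
      |normConst α β| * (‖trigPoly α β r x y s‖ * distSq r s ^ ((α + β + 2) / 2)) /
        weight 1 r := by
  rw [norm_polarKernel_moebiusAngle α β hr hr1, weight, ← mul_assoc]
  norm_num

theorem bddAbove_trigPoly {α β r : ℝ} (h : Admissible α β) (hr : 0 ≤ r) (hr1 : r < 1) (x y : ℂ) :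
    BddAbove (range fun s : ℝ => ‖trigPoly α β r x y s‖ * distSq r s ^ ((α + β + 2) / 2)) := by
  obtain ⟨M, hM⟩ := isCompact_univ.exists_bound_of_continuousOn
    (continuous_polarKernel h hr hr1 x y).continuousOn
  refine ⟨M * weight 1 r / |normConst α β|, ?_⟩
  rintro _ ⟨s, rfl⟩
  have h1 := hM (moebiusAngle r s : T) (mem_univ _)
  have hc := abs_pos.2 (normConst_ne_zero h)
  rw [norm_polarKernel_one hr hr1, div_le_iff₀ (weight_pos 1 hr hr1)] at h1
  rw [le_div_iff₀ hc, mul_comm]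
  exact h1

theorem norm_polarKernel_le_one {α β r : ℝ} (h : Admissible α β) (hr : 0 ≤ r) (hr1 : r < 1)
    (x y : ℂ) (τ : T) : ‖polarKernel α β r x y τ‖ ≤ sharpConst α β 1 r x y / weight 1 r := by
  obtain ⟨s, rfl⟩ := exists_moebiusAngle_eq hr hr1 τ
  rw [norm_polarKernel_one hr hr1, sharpConst, if_pos rfl]
  have hw := weight_pos 1 hr hr1
  gcongr
  exact le_ciSup (bddAbove_trigPoly h hr hr1 x y) s

theorem norm_polarIntegral_le {p : ℝ≥0∞} (hp : 1 ≤ p) {α β r : ℝ} (h : Admissible α β)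
    (hr : 0 ≤ r) (hr1 : r < 1) (θ : ℝ) (x y : ℂ) {f : T → ℂ} (hf : MemLp f p m) :
    ‖polarIntegral α β f r θ x y‖ ≤ sharpConst α β p r x y / weight p r * lpNorm p f := by
  by_cases hp1 : p = 1
  · subst hp1
    exact norm_integral_mul_le_one (fun t => norm_polarKernel_le_one h hr hr1 x y _) hf
  · rw [← rpow_integral_polarKernel hp hp1 h hr hr1]
    have h1 := norm_integral_mul_le hp hp1
      (k := fun t => polarKernel α β r x y ((θ : T) - t))
      ((continuous_polarKernel h hr hr1 x y).comp (by fun_prop)) hf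
    rwa [integral_sub_left_eq_self (fun τ => ‖polarKernel α β r x y τ‖ ^ conjExp p) m] at h1

/-- The converse of Hölder's inequality at one fixed point $re^{i\theta}$. For $p>1$ the reflection
$t\mapsto\theta-t$ preserves the measure, so $\theta$ drops out of the kernel norm; for $p=1$ the
test point is chosen so that $\theta$ cancels. -/
theorem sharpConst_le {p : ℝ≥0∞} (hp : 1 ≤ p) {α β r : ℝ} (h : Admissible α β)
    (hr : 0 ≤ r) (hr1 : r < 1) (θ : ℝ) (x y : ℂ) {K : ℝ} (hK : ∀ f : T → ℂ, MemLp f p m →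
      ‖polarIntegral α β f r θ x y‖ ≤ K / weight p r * lpNorm p f) :
    sharpConst α β p r x y ≤ K := by
  have hw := weight_pos p hr hr1
  have hc : Continuous fun t => polarKernel α β r x y ((θ : T) - t) :=
    (continuous_polarKernel h hr hr1 x y).comp (by fun_prop)
  by_cases hp1 : p = 1
  · subst hp1
    rw [sharpConst, if_pos rfl, Real.mul_iSup_of_nonneg (abs_nonneg _)]
    refine ciSup_le fun s => ?_
    have h1 := norm_le_of_forall_norm_integral_le hc hK ((θ : T) - (moebiusAngle r s : T))
    rw [sub_sub_cancel, norm_polarKernel_one hr hr1] at h1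
    exact (div_le_div_iff_of_pos_right hw).1 h1
  · have h1 := rpow_integral_le_of_forall_norm_integral_le hp hp1 hc hK
    rw [integral_sub_left_eq_self (fun τ => ‖polarKernel α β r x y τ‖ ^ conjExp p) m,
      rpow_integral_polarKernel hp hp1 h hr hr1] at h1
    exact (div_le_div_iff_of_pos_right hw).1 h1

/-! ### Integrals of powers of `distSq` up to the boundary radius -/

/-- On $(0,\pi/2]$ Jordan's inequality $\sin s\ge 2s/\pi$ compares the integrand with a multiple of
$s^{2l}$, where $2l>-1$. Reflection in $\pi/2$ and the period $\pi$ give the rest. -/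
theorem intervalIntegrable_sin_sq_rpow {l : ℝ} (hl : -(1 / 2) < l) (hl0 : l ≤ 0) (a b : ℝ) :
    IntervalIntegrable (fun s => (Real.sin s ^ 2) ^ l) volume a b := by
  have hm : Measurable fun s => (Real.sin s ^ 2) ^ l :=
    (Real.continuous_sin.measurable.pow_const 2).pow_const l
  have h1 : IntervalIntegrable (fun s => (Real.sin s ^ 2) ^ l) volume 0 (π / 2) := by
    have h2 : IntervalIntegrable (fun s : ℝ => ((2 / π) ^ (2 * l)) * s ^ (2 * l)) volume 0 (π / 2) :=
      (intervalIntegral.intervalIntegrable_rpow' (by linarith)).const_mul _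
    refine h2.mono_fun hm.aestronglyMeasurable ?_
    rw [EventuallyLE, ae_restrict_iff' measurableSet_uIoc]
    refine Eventually.of_forall fun s hs => ?_
    rw [uIoc_of_le (by positivity)] at hs
    have h3 := Real.mul_le_sin hs.1.le hs.2
    have h4 : 0 < 2 / π * s := mul_pos (by positivity) hs.1
    have h5 : 0 ≤ Real.sin s := h4.le.trans h3
    rw [Real.norm_of_nonneg (by positivity), Real.norm_of_nonneg
      (mul_nonneg (by positivity) (Real.rpow_nonneg hs.1.le _)),
      ← Real.mul_rpow (by positivity) hs.1.le, ← Real.rpow_natCast, ← Real.rpow_mul h5]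
    exact Real.rpow_le_rpow_of_nonpos h4 h3 (by norm_num; linarith)
  have h2 : IntervalIntegrable (fun s => (Real.sin s ^ 2) ^ l) volume (π / 2) π := by
    have := (h1.comp_sub_left π).symm
    simp only [Real.sin_pi_sub, sub_zero] at this
    convert this using 1
    ring
  have h3 : IntervalIntegrable (fun s => (Real.sin s ^ 2) ^ l) volume 0 (0 + π) := by
    rw [zero_add]
    exact h1.trans h2
  refine Function.Periodic.intervalIntegrable (T := π) (fun s => ?_) Real.pi_pos.ne' h3 a b
  simp

theorem ae_sin_ne_zero : ∀ᵐ s : ℝ, Real.sin s ≠ 0 := by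
  have hc : {s : ℝ | Real.sin s = 0}.Countable := by
    refine (countable_range fun n : ℤ => (n : ℝ) * π).mono fun s hs => ?_
    exact Real.sin_eq_zero_iff.1 hs
  exact hc.ae_notMem volume

/-- The difference is $(r+\cos s)^2$. The lower bound does not depend on $r$, hence survives at
$r=1$, where `distSq` vanishes at $s=\pi$. -/
theorem sin_sq_le_distSq (r s : ℝ) : Real.sin s ^ 2 ≤ distSq r s := by
  rw [distSq]
  nlinarith [Real.sin_sq_add_cos_sq s, sq_nonneg (r + Real.cos s)]

theorem distSq_nonneg (r s : ℝ) : 0 ≤ distSq r s := (sq_nonneg _).trans (sin_sq_le_distSq r s)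

theorem continuous_distSq : Continuous fun x : ℝ × ℝ => distSq x.1 x.2 := by
  unfold distSq
  fun_prop

/-- Where `distSq` is at most $1$ the smallest exponent $l$ dominates, and elsewhere the largest
exponent $u$ does. The majorant is uniform in $\kappa\in[l,u]$ and in $r$. -/
theorem distSq_rpow_le {l κ u B r s : ℝ} (hs : Real.sin s ≠ 0) (hl0 : l ≤ 0) (hlκ : l ≤ κ)
    (hu0 : 0 ≤ u) (hκu : κ ≤ u) (hB : distSq r s ≤ B) :
    distSq r s ^ κ ≤ (Real.sin s ^ 2) ^ l + B ^ u := by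
  have h0 : 0 < Real.sin s ^ 2 := by positivity
  have h1 := sin_sq_le_distSq r s
  have h2 := h0.trans_le h1
  have h3 : 0 ≤ B ^ u := Real.rpow_nonneg (h2.le.trans hB) _
  have h4 : 0 ≤ (Real.sin s ^ 2) ^ l := by positivity
  rcases le_total (distSq r s) 1 with h | h
  · have := (Real.rpow_le_rpow_of_exponent_ge h2 h hlκ).trans
      (Real.rpow_le_rpow_of_nonpos h0 h1 hl0)
    linarith
  · have := (Real.rpow_le_rpow_of_exponent_le h hκu).trans (Real.rpow_le_rpow h2.le hB hu0)
    linarith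

/-- Dominated convergence with the majorant of `distSq_rpow_le`. The radius and the exponent may
move together, and $r=1$ is allowed as long as $\kappa>-\tfrac12$. -/
theorem continuousAt_integral_distSq {X : Type*} [TopologicalSpace X] [FirstCountableTopology X]
    [LocallyCompactSpace X] {g : X → ℝ → ℝ} (hg : Continuous (Function.uncurry g)) {κ ρ : X → ℝ}
    (hκ : Continuous κ) (hρ : Continuous ρ) {x₀ : X} (hx : -(1 / 2) < κ x₀) :
    ContinuousAt (fun x => ∫ s in (0 : ℝ)..(2 * π), g x s * distSq (ρ x) s ^ κ x) x₀ := by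
  -- An exponent strictly between $-\tfrac12$ and $\min(\kappa(x_0),0)$ keeps $(\sin^2 s)^l$
  -- integrable and stays below $\kappa(x)$ for $x$ near $x_0$.
  obtain ⟨l, hl, hl'⟩ := exists_between (lt_min hx (by norm_num : -(1 / 2 : ℝ) < 0))
  have hlκ := hl'.trans_le (min_le_left _ _)
  have hl0 := hl'.trans_le (min_le_right _ _)
  set u : ℝ := max (κ x₀ + 1) 0
  have hU : {x | l < κ x ∧ κ x < u} ∈ 𝓝 x₀ := by
    refine ((isOpen_lt continuous_const hκ).inter (isOpen_lt hκ continuous_const)).mem_nhds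
      ⟨hlκ, ?_⟩
    exact (lt_add_one (κ x₀)).trans_le (le_max_left _ _)
  obtain ⟨N, hN, hNU, hNc⟩ := local_compact_nhds hU
  have hNI := hNc.prod (isCompact_Icc (a := (0 : ℝ)) (b := 2 * π))
  obtain ⟨M, hM⟩ := hNI.exists_bound_of_continuousOn hg.continuousOn
  obtain ⟨B, hB⟩ := hNI.exists_bound_of_continuousOn (f := fun x : X × ℝ => distSq (ρ x.1) x.2)
    (continuous_distSq.comp ((hρ.comp continuous_fst).prodMk continuous_snd)).continuousOn
  have hIcc : ∀ s ∈ uIoc (0 : ℝ) (2 * π), s ∈ Icc (0 : ℝ) (2 * π) := fun s hs => by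
    rw [uIoc_of_le Real.two_pi_pos.le] at hs
    exact Ioc_subset_Icc_self hs
  refine intervalIntegral.continuousAt_of_dominated_interval
    (bound := fun s => M * ((Real.sin s ^ 2) ^ l + B ^ u)) ?_ ?_ ?_ ?_
  · refine Eventually.of_forall fun x => Measurable.aestronglyMeasurable ?_
    have h1 : Continuous fun s => g x s := hg.comp (by fun_prop : Continuous fun s : ℝ => (x, s))
    have h2 : Continuous fun s => distSq (ρ x) s := by unfold distSq; fun_prop
    exact h1.measurable.mul (h2.measurable.pow_const _)
  · filter_upwards [hN] with x hxN
    filter_upwards [ae_sin_ne_zero] with s hs hsI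
    have hm : (x, s) ∈ N ×ˢ Icc (0 : ℝ) (2 * π) := ⟨hxN, hIcc s hsI⟩
    have h1 := hNU hxN
    have h2 : distSq (ρ x) s ≤ B := (le_abs_self _).trans (hB _ hm)
    rw [norm_mul, Real.norm_of_nonneg (Real.rpow_nonneg (distSq_nonneg _ _) _)]
    exact mul_le_mul (hM _ hm)
      (distSq_rpow_le hs hl0.le h1.1.le (le_max_right _ _) h1.2.le h2)
      (Real.rpow_nonneg (distSq_nonneg _ _) _) ((norm_nonneg _).trans (hM _ hm))
  · exact ((intervalIntegrable_sin_sq_rpow hl hl0.le _ _).add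
      intervalIntegrable_const).const_mul _
  · filter_upwards [ae_sin_ne_zero] with s hs _
    have h1 : ContinuousAt (fun x => g x s) x₀ :=
      (hg.comp (by fun_prop : Continuous fun x : X => (x, s))).continuousAt
    have h2 : Continuous fun x => distSq (ρ x) s :=
      continuous_distSq.comp (hρ.prodMk continuous_const)
    refine h1.mul (h2.continuousAt.rpow hκ.continuousAt (Or.inl ?_))
    have : 0 < Real.sin s ^ 2 := by positivity
    exact (this.trans_le (sin_sq_le_distSq _ _)).ne'

theorem intervalIntegrable_distSq_rpow {κ : ℝ} (hκ : -(1 / 2) < κ) (r : ℝ) :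
    IntervalIntegrable (fun s => distSq r s ^ κ) volume 0 (2 * π) := by
  have hc : Continuous fun s => distSq r s := by unfold distSq; fun_prop
  obtain ⟨l, hl, hl'⟩ := exists_between (lt_min hκ (by norm_num : -(1 / 2 : ℝ) < 0))
  have hlκ := hl'.trans_le (min_le_left _ _)
  have hl0 := hl'.trans_le (min_le_right _ _)
  obtain ⟨B, hB⟩ := (isCompact_Icc (a := (0 : ℝ)) (b := 2 * π)).exists_bound_of_continuousOn
    hc.continuousOn
  refine ((intervalIntegrable_sin_sq_rpow hl hl0.le 0 (2 * π)).add
    (intervalIntegrable_const (c := B ^ max κ 0))).mono_fun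
    (hc.measurable.pow_const _).aestronglyMeasurable ?_
  rw [EventuallyLE, ae_restrict_iff' measurableSet_uIoc]
  filter_upwards [ae_sin_ne_zero] with s hs hsI
  rw [uIoc_of_le Real.two_pi_pos.le] at hsI
  rw [Real.norm_of_nonneg (Real.rpow_nonneg (distSq_nonneg _ _) _)]
  exact (distSq_rpow_le hs hl0.le hlκ.le (le_max_right _ _) (le_max_left _ _)
    ((le_abs_self _).trans (hB s (Ioc_subset_Icc_self hsI)))).trans (le_abs_self _)

/-! ### The value of the integral at radius one -/

theorem beta_eq_integral {a b : ℝ} (ha : 0 < a) (hb : 0 < b) :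
    ProbabilityTheory.beta a b = ∫ x in Ioo (0 : ℝ) 1, x ^ (a - 1) * (1 - x) ^ (b - 1) := by
  rw [ProbabilityTheory.beta_eq_betaIntegralReal a b ha hb, Complex.betaIntegral,
    intervalIntegral.integral_of_le zero_le_one, integral_Ioc_eq_integral_Ioo]
  have h1 : ∫ x in Ioo (0 : ℝ) 1, (x : ℂ) ^ ((a : ℂ) - 1) * (1 - (x : ℂ)) ^ ((b : ℂ) - 1) =
      ∫ x in Ioo (0 : ℝ) 1, ((x ^ (a - 1) * (1 - x) ^ (b - 1) : ℝ) : ℂ) := by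
    refine setIntegral_congr_fun measurableSet_Ioo fun x hx => ?_
    rw [Complex.ofReal_mul, Complex.ofReal_cpow hx.1.le, Complex.ofReal_cpow (by linarith [hx.2])]
    push_cast
    rfl
  rw [h1, integral_complex_ofReal, Complex.ofReal_re]

/-- Here `distSq 1 s` equals $2(1+\cos s)$. By symmetry half a period suffices, and $X=(1+\cos s)/2$
maps it to $4^\kappa B(\kappa+\tfrac12,\tfrac12)$. Legendre's duplication formula then removes the
half-integer shift. -/
theorem integral_distSq_one {κ : ℝ} (hκ : -(1 / 2) < κ) :
    1 / (2 * π) * ∫ s in (0 : ℝ)..(2 * π), distSq 1 s ^ κ =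
      Real.Gamma (2 * κ + 1) / Real.Gamma (κ + 1) ^ 2 := by
  have hi := intervalIntegrable_distSq_rpow hκ 1
  have hsplit : ∫ s in (0 : ℝ)..(2 * π), distSq 1 s ^ κ =
      2 * ∫ s in (0 : ℝ)..π, distSq 1 s ^ κ := by
    have hpi := Real.pi_pos
    have hp : π ∈ uIcc 0 (2 * π) := by
      rw [uIcc_of_le (by linarith)]
      constructor <;> linarith
    rw [← intervalIntegral.integral_add_adjacent_intervals (b := π)
      (hi.mono_set (uIcc_subset_uIcc_left hp)) (hi.mono_set (uIcc_subset_uIcc_right hp))]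
    have := intervalIntegral.integral_comp_sub_left (a := 0) (b := π)
      (fun s => distSq 1 s ^ κ) (2 * π)
    rw [show 2 * π - π = π by ring, sub_zero] at this
    rw [← this, two_mul (∫ s in (0 : ℝ)..π, distSq 1 s ^ κ)]
    congr 1
    apply intervalIntegral.integral_congr
    intro s _
    simp [distSq, Real.cos_two_pi_sub]
  have hbeta : ∫ s in (0 : ℝ)..π, distSq 1 s ^ κ =
      4 ^ κ * ProbabilityTheory.beta (κ + 1 / 2) (1 / 2) := by
    have himg : (fun s => (1 + Real.cos s) / 2) '' Ioo 0 π = Ioo 0 1 := by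
      ext x
      constructor
      · rintro ⟨s, hs, rfl⟩
        have h1 : Real.cos s < 1 := by
          rw [← Real.cos_zero]
          exact Real.cos_lt_cos_of_nonneg_of_le_pi le_rfl hs.2.le hs.1
        have h2 : -1 < Real.cos s := by
          rw [← Real.cos_pi]
          exact Real.cos_lt_cos_of_nonneg_of_le_pi hs.1.le le_rfl hs.2
        constructor <;> simp only <;> linarith
      · intro hx
        refine ⟨Real.arccos (2 * x - 1), ⟨?_, ?_⟩, ?_⟩
        · exact Real.arccos_pos.2 (by linarith [hx.2])
        · refine lt_of_le_of_ne (Real.arccos_le_pi _) fun h => ?_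
          have := Real.arccos_eq_pi.1 h
          linarith [hx.1]
        · simp only
          rw [Real.cos_arccos (by linarith [hx.1]) (by linarith [hx.2])]
          ring
    rw [beta_eq_integral (by linarith) (by norm_num), ← himg,
      integral_image_eq_integral_abs_deriv_smul (f' := fun s => -Real.sin s / 2) measurableSet_Ioo,
      intervalIntegral.integral_of_le Real.pi_pos.le, integral_Ioc_eq_integral_Ioo,
      ← integral_const_mul]
    · refine setIntegral_congr_fun measurableSet_Ioo fun s hs => ?_
      have hsin := Real.sin_pos_of_pos_of_lt_pi hs.1 hs.2
      have hX : 0 < (1 + Real.cos s) / 2 ∧ (1 + Real.cos s) / 2 < 1 := by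
        have : (1 + Real.cos s) / 2 ∈ Ioo (0 : ℝ) 1 := himg ▸ mem_image_of_mem _ hs
        exact this
      set X := (1 + Real.cos s) / 2 with hXd
      -- The Jacobian of $X$ is $\sin s/2=\sqrt{X(1-X)}$ in absolute value.
      have hs2 : Real.sin s / 2 = X ^ (1 / 2 : ℝ) * (1 - X) ^ (1 / 2 : ℝ) := by
        rw [← Real.mul_rpow hX.1.le (by linarith [hX.2]), ← Real.sqrt_eq_rpow]
        symm
        rw [Real.sqrt_eq_iff_mul_self_eq (mul_nonneg hX.1.le (by linarith [hX.2])) (by positivity),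
          hXd]
        nlinarith [Real.sin_sq_add_cos_sq s]
      have hd : distSq 1 s = 4 * X := by
        rw [distSq, hXd]
        ring
      have hY : 0 < 1 - X := by linarith [hX.2]
      simp only [smul_eq_mul]
      rw [neg_div, abs_neg, abs_of_pos (by positivity), hs2, hd, Real.mul_rpow (by norm_num) hX.1.le,
        show κ + 1 / 2 - 1 = κ - 1 / 2 by ring, Real.rpow_sub hX.1,
        show (1 / 2 : ℝ) - 1 = -(1 / 2) by norm_num, Real.rpow_neg hY.le]
      have e1 := (Real.rpow_pos_of_pos hX.1 (1 / 2)).ne'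
      have e2 := (Real.rpow_pos_of_pos hY (1 / 2)).ne'
      field_simp
    · intro s _
      have := ((Real.hasDerivAt_cos s).const_add 1).div_const 2
      exact this.hasDerivWithinAt
    · intro a ha b hb hab
      refine Real.injOn_cos ⟨ha.1.le, ha.2.le⟩ ⟨hb.1.le, hb.2.le⟩ ?_
      simp only at hab
      linarith
  have hG := Real.Gamma_mul_Gamma_add_half (κ + 1 / 2)
  have hG1 := (Real.Gamma_pos_of_pos (show 0 < κ + 1 by linarith)).ne'
  rw [show κ + 1 / 2 + 1 / 2 = κ + 1 by ring, show 2 * (κ + 1 / 2) = 2 * κ + 1 by ring,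
    show 1 - (2 * κ + 1) = -(2 * κ) by ring, Real.rpow_neg (by norm_num), Real.rpow_mul (by norm_num),
    show (2 : ℝ) ^ (2 : ℝ) = 4 by norm_num] at hG
  have h4 : (0 : ℝ) < 4 ^ κ := by positivity
  rw [hsplit, hbeta, ProbabilityTheory.beta, show κ + 1 / 2 + 1 / 2 = κ + 1 by ring,
    Real.Gamma_one_half_eq, eq_div_iff (by positivity)]
  have hsp : √π ≠ 0 := (Real.sqrt_pos.2 Real.pi_pos).ne'
  have hG2 : Real.Gamma (κ + 1 / 2) = Real.Gamma (2 * κ + 1) * (4 ^ κ)⁻¹ * √π / Real.Gamma (κ + 1) := by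
    rw [eq_div_iff hG1, hG]
  rw [hG2]
  field_simp
  rw [Real.sq_sqrt Real.pi_pos.le, mul_comm]

/-! ### Monotonicity of the circle means in the radius -/

theorem differentiableOn_intervalIntegral {G G' : ℂ → ℝ → ℂ} {U : Set ℂ} (hU : IsOpen U)
    (a b : ℝ) (hG : ContinuousOn (Function.uncurry G) (U ×ˢ univ))
    (hG' : ContinuousOn (Function.uncurry G') (U ×ˢ univ))
    (hd : ∀ w ∈ U, ∀ s, HasDerivAt (fun w => G w s) (G' w s) w) :
    DifferentiableOn ℂ (fun w => ∫ s in a..b, G w s) U := by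
  intro w hw
  obtain ⟨N, hN, hNU, hNc⟩ := local_compact_nhds (hU.mem_nhds hw)
  obtain ⟨M, hM⟩ := (hNc.prod (isCompact_uIcc (a := a) (b := b))).exists_bound_of_continuousOn
    (hG'.mono (prod_mono hNU (subset_univ _)))
  have hs : ∀ {H : ℂ → ℝ → ℂ}, ContinuousOn (Function.uncurry H) (U ×ˢ univ) → ∀ v ∈ U,
      Continuous (H v) := by
    intro H hH v hv
    rw [← continuousOn_univ]
    exact hH.comp (f := fun s : ℝ => (v, s)) (by fun_prop) fun s _ => ⟨hv, mem_univ _⟩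
  have h := intervalIntegral.hasDerivAt_integral_of_dominated_loc_of_deriv_le (μ := volume)
    (F := G) (F' := G') (a := a) (b := b) (bound := fun _ => M) hN ?_
    ((hs hG w hw).intervalIntegrable _ _) (hs hG' w hw).aestronglyMeasurable ?_
    intervalIntegrable_const ?_
  · exact h.2.differentiableAt.differentiableWithinAt
  · filter_upwards [hU.mem_nhds hw] with v hv using (hs hG v hv).aestronglyMeasurable
  · exact Eventually.of_forall fun s hsI v hv => hM (v, s) ⟨hv, uIoc_subset_uIcc hsI⟩
  · exact Eventually.of_forall fun s _ v hv => hd v (hNU hv) s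

theorem norm_one_add_cpow (κ : ℝ) (r s : ℝ) :
    ‖(1 + (r : ℂ) * unit (s : T)) ^ (κ : ℂ)‖ ^ 2 = distSq r s ^ κ := by
  rw [Complex.norm_cpow_real, ← normSq_one_add, Complex.normSq_eq_norm_sq, ← Real.rpow_natCast,
    ← Real.rpow_natCast, ← Real.rpow_mul (norm_nonneg _), ← Real.rpow_mul (norm_nonneg _), mul_comm κ]

theorem integral_distSq_shift (r κ ψ : ℝ) :
    ∫ s in (0 : ℝ)..(2 * π), distSq r (ψ + s) ^ κ = ∫ s in (0 : ℝ)..(2 * π), distSq r s ^ κ := by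
  have hp : Function.Periodic (fun s => distSq r s ^ κ) (2 * π) := fun s => by
    simp [distSq, Real.cos_add_two_pi]
  have := hp.intervalIntegral_add_eq ψ 0
  rw [zero_add] at this
  rw [intervalIntegral.integral_comp_add_left (fun s => distSq r s ^ κ), add_zero, this]

/-- Let $g(z)=(1+z)^\kappa$, let $M(r)$ be the integral of $|g(re^{is})|^2$, and put $F(w)=\int
g(we^{is})\,\overline{g(re^{is})}\,ds$, which is holomorphic in the disk. Then $F(r)=M(r)$, while
$|F|\le\frac12(M(R)+M(r))$ on $|w|=R$. The maximum principle gives $M(r)\le\frac12(M(R)+M(r))$, that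
is, $M(r)\le M(R)$. -/
theorem integral_distSq_mono {κ r R : ℝ} (hr : 0 ≤ r) (hrR : r ≤ R) (hR : R < 1) :
    ∫ s in (0 : ℝ)..(2 * π), distSq r s ^ κ ≤ ∫ s in (0 : ℝ)..(2 * π), distSq R s ^ κ := by
  rcases hrR.eq_or_lt with rfl | hlt
  · exact le_rfl
  have hR0 : 0 < R := hr.trans_lt hlt
  have hr1 : r < 1 := hlt.trans hR
  have hcu : Continuous fun s : ℝ => unit (s : T) := continuous_unit.comp (AddCircle.continuous_mk' _)
  set g : ℂ → ℂ := fun z => (1 + z) ^ (κ : ℂ) with hg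
  set h : ℝ → ℂ := fun s => conj (g (r * unit (s : T))) with hh
  have hslit : ∀ w : ℂ, ‖w‖ < 1 → 1 + w ∈ Complex.slitPlane := fun w hw => by
    have := one_sub_mem_slitPlane (z := -w) (by rwa [norm_neg])
    rwa [sub_neg_eq_add] at this
  have hwu : ∀ w ∈ Metric.ball (0 : ℂ) 1, ∀ s : ℝ, ‖w * unit (s : T)‖ < 1 := fun w hw s => by
    simpa [norm_unit] using hw
  have hh_cont : Continuous h := by
    refine Complex.continuous_conj.comp (continuous_iff_continuousAt.2 fun s => ?_)
    refine ContinuousAt.cpow ?_ continuousAt_const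
      (hslit _ (norm_mul_unit_lt hr hr1 _))
    exact (continuous_const.add (continuous_const.mul hcu)).continuousAt
  have hu2 : Continuous fun x : ℂ × ℝ => unit (x.2 : T) := hcu.comp continuous_snd
  have hbase : Continuous fun x : ℂ × ℝ => 1 + x.1 * unit (x.2 : T) :=
    continuous_const.add (continuous_fst.mul hu2)
  have hd := differentiableOn_intervalIntegral (U := Metric.ball (0 : ℂ) 1)
    (G := fun w s => g (w * unit (s : T)) * h s)
    (G' := fun w s => ((κ : ℂ) * (1 + w * unit (s : T)) ^ ((κ : ℂ) - 1) * unit (s : T)) * h s)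
    Metric.isOpen_ball 0 (2 * π) ?_ ?_ ?_
  rotate_left
  · exact (hbase.continuousOn.cpow continuousOn_const fun x hx => hslit _ (hwu _ hx.1 _)).mul
      (hh_cont.comp continuous_snd).continuousOn
  · exact ((continuousOn_const.mul (hbase.continuousOn.cpow continuousOn_const
      fun x hx => hslit _ (hwu _ hx.1 _))).mul hu2.continuousOn).mul
      (hh_cont.comp continuous_snd).continuousOn
  · intro w hw s
    have h1 : HasDerivAt (fun w : ℂ => 1 + w * unit (s : T)) (unit (s : T)) w := by
      simpa using ((hasDerivAt_id w).mul_const (unit (s : T))).const_add 1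
    exact (h1.cpow_const (hslit _ (hwu w hw s))).mul_const (h s)
  set F : ℂ → ℂ := fun w => ∫ s in (0 : ℝ)..(2 * π), g (w * unit (s : T)) * h s with hF
  set M : ℝ → ℝ := fun r => ∫ s in (0 : ℝ)..(2 * π), distSq r s ^ κ with hM
  have hcont : ∀ ρ : ℝ, 0 ≤ ρ → ρ < 1 → ∀ ψ : ℝ, Continuous fun s => distSq ρ (ψ + s) ^ κ :=
    fun ρ h0 h1 ψ => by
      have hc : Continuous fun s => distSq ρ (ψ + s) := by unfold distSq; fun_prop
      exact hc.rpow_const fun s => Or.inl (distSq_pos h0 h1 _).ne'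
  have hnh : ∀ s, ‖h s‖ ^ 2 = distSq r s ^ κ := fun s => by
    rw [hh, Complex.norm_conj, hg, norm_one_add_cpow]
  have hFr : F r = (M r : ℂ) := by
    rw [hF, hM, ← intervalIntegral.integral_ofReal]
    refine intervalIntegral.integral_congr fun s _ => ?_
    simp only [hh]
    rw [Complex.mul_conj, Complex.normSq_eq_norm_sq, hg, norm_one_add_cpow]
  have hfr : ∀ w ∈ frontier (Metric.ball (0 : ℂ) R), ‖F w‖ ≤ (M R + M r) / 2 := by
    intro w hw
    rw [frontier_ball _ hR0.ne', mem_sphere_zero_iff_norm] at hw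
    have hwp : w = R * unit (w.arg : T) := by
      rw [unit_coe, ← hw, Complex.norm_mul_exp_arg_mul_I]
    have hmul : ∀ s : ℝ, w * unit (s : T) = R * unit ((w.arg + s : ℝ) : T) := fun s => by
      conv_lhs => rw [hwp]
      rw [unit_coe, unit_coe, unit_coe, mul_assoc, ← Complex.exp_add]
      push_cast
      ring_nf
    have hi1 : IntervalIntegrable (fun s => distSq R (w.arg + s) ^ κ) volume 0 (2 * π) :=
      (hcont R hR0.le hR _).intervalIntegrable _ _
    have hi2 : IntervalIntegrable (fun s => distSq r s ^ κ) volume 0 (2 * π) := by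
      simpa using (hcont r hr hr1 0).intervalIntegrable (μ := volume) 0 (2 * π)
    calc ‖F w‖ ≤ ∫ s in (0 : ℝ)..(2 * π), (distSq R (w.arg + s) ^ κ + distSq r s ^ κ) / 2 := by
          refine intervalIntegral.norm_integral_le_of_norm_le Real.two_pi_pos.le
            (Eventually.of_forall fun s _ => ?_) ((hi1.add hi2).div_const 2)
          rw [norm_mul, hmul, ← norm_one_add_cpow, ← hnh]
          -- This is $ab\le(a^2+b^2)/2$ for the moduli of the two factors.
          nlinarith [sq_nonneg (‖g (R * unit ((w.arg + s : ℝ) : T))‖ - ‖h s‖)]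
      _ = (M R + M r) / 2 := by
          rw [intervalIntegral.integral_div, intervalIntegral.integral_add hi1 hi2,
            integral_distSq_shift]
  have hDC : DiffContOnCl ℂ F (Metric.ball (0 : ℂ) R) := by
    refine DifferentiableOn.diffContOnCl (hd.mono ?_)
    rw [closure_ball _ hR0.ne']
    exact Metric.closedBall_subset_ball hR
  have hmax := Complex.norm_le_of_forall_mem_frontier_norm_le Metric.isBounded_ball hDC hfr
    (z := (r : ℂ)) (subset_closure (by simpa [abs_of_nonneg hr] using hlt))
  rw [hFr, Complex.norm_real] at hmax
  have := (le_abs_self _).trans hmax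
  linarith

theorem tendsto_integral_distSq_one {κ : ℝ} (hκ : -(1 / 2) < κ) :
    Tendsto (fun r => ∫ s in (0 : ℝ)..(2 * π), distSq r s ^ κ) (𝓝[<] 1)
      (𝓝 (∫ s in (0 : ℝ)..(2 * π), distSq 1 s ^ κ)) := by
  have := continuousAt_integral_distSq (X := ℝ) (g := fun _ _ => 1) (κ := fun _ => κ)
    (ρ := fun r => r) continuous_const continuous_const continuous_id (x₀ := 1) hκ
  simp only [one_mul] at this
  exact this.tendsto.mono_left nhdsWithin_le_nhds

/-- The maximum principle works only for $R<1$; continuity of the integral at $R=1$ carries the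
inequality to the boundary. -/
theorem integral_distSq_le_one {κ r : ℝ} (hκ : -(1 / 2) < κ) (hr : 0 ≤ r) (hr1 : r < 1) :
    ∫ s in (0 : ℝ)..(2 * π), distSq r s ^ κ ≤ ∫ s in (0 : ℝ)..(2 * π), distSq 1 s ^ κ := by
  refine ge_of_tendsto (tendsto_integral_distSq_one hκ) ?_
  filter_upwards [Ioo_mem_nhdsLT hr1] with R hR
  exact integral_distSq_mono hr hR.1.le hR.2

/-! ### Suprema over the radius -/

/-- The open interval is dense in the closed one, so continuity makes the two suprema equal, and
compactness makes them finite. -/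
theorem isLUB_image_Ioo {F : ℝ → ℝ} (hF : ContinuousOn F (Icc 0 1)) :
    IsLUB (F '' Ioo 0 1) (sSup (F '' Ioo 0 1)) ∧ sSup (F '' Ioo 0 1) = sSup (F '' Icc 0 1) := by
  have hb : BddAbove (F '' Icc 0 1) := (isCompact_Icc.image_of_continuousOn hF).bddAbove
  have hsub : F '' Ioo 0 1 ⊆ F '' Icc 0 1 := image_mono Ioo_subset_Icc_self
  have hne : (F '' Ioo 0 1).Nonempty := (nonempty_Ioo.2 zero_lt_one).image F
  have h1 := isLUB_csSup hne (hb.mono hsub)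
  refine ⟨h1, ?_⟩
  have hcl : F '' Icc 0 1 ⊆ closure (F '' Ioo 0 1) := by
    rw [← closure_Ioo zero_ne_one]
    rw [← closure_Ioo zero_ne_one] at hF
    exact hF.image_closure
  refine le_antisymm (csSup_le_csSup hb hne hsub) (csSup_le (hne.mono hsub) fun y hy => ?_)
  have h2 : closure (F '' Ioo 0 1) ⊆ Iic (sSup (F '' Ioo 0 1)) :=
    closure_minimal (fun z hz => h1.1 hz) isClosed_Iic
  exact h2 (hcl hy)

/-- A supremum over a compact set is continuous in the parameters when the function is jointly
continuous. For this reason the open interval is replaced by the closed one. -/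
theorem continuousOn_sSup_image {F : ℝ × ℝ → ℝ → ℝ} {S : Set (ℝ × ℝ)}
    (hF : ContinuousOn (Function.uncurry F) (S ×ˢ Icc 0 1)) :
    ContinuousOn (fun x => sSup (F x '' Ioo 0 1)) S := by
  have hslice : ∀ x ∈ S, ContinuousOn (F x) (Icc 0 1) := fun x hx =>
    hF.comp (f := fun r : ℝ => (x, r)) (by fun_prop) fun r hr => ⟨hx, hr⟩
  refine ContinuousOn.congr ?_ fun x hx => (isLUB_image_Ioo (hslice x hx)).2
  rw [continuousOn_iff_continuous_domRestrict]
  have hc : Continuous (Function.uncurry fun (x : S) (r : Icc (0 : ℝ) 1) => F x r) := by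
    rw [← continuousOn_univ]
    exact hF.comp (f := fun y : S × Icc (0 : ℝ) 1 => ((y.1 : ℝ × ℝ), (y.2 : ℝ))) (by fun_prop)
      fun y _ => ⟨y.1.2, y.2.2⟩
  have := isCompact_univ.continuous_sSup
    (f := fun (x : S) (r : Icc (0 : ℝ) 1) => F x r) hc
  refine this.congr fun x => ?_
  simp only [domRestrict_apply]
  congr 1
  ext y
  simp

/-! ### Upper bounds for the exact constant -/

/-- Convexity of $t\mapsto t^q$: the graph lies above its tangent at $a+b$. This is Bernoulli's
inequality at $-b/(a+b)$. -/
theorem rpow_add_le {a b N q : ℝ} (ha : 0 ≤ a) (hb : 0 ≤ b) (hN : a + b ≤ N) (hq : 1 ≤ q) :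
    (a + b) ^ q ≤ a ^ q + q * N ^ (q - 1) * b := by
  have hN0 : 0 ≤ N := (add_nonneg ha hb).trans hN
  have h1 : (a + b) ^ q ≤ a ^ q + q * (a + b) ^ (q - 1) * b := by
    rcases (add_nonneg ha hb).eq_or_lt with h0 | hpos
    · have h2 : a = 0 := by linarith
      have h3 : b = 0 := by linarith
      simp [h2, h3]
    · have h2 := one_add_mul_self_le_rpow_one_add (s := -b / (a + b)) (p := q)
        (by rw [le_div_iff₀ hpos]; linarith) hq
      have h3 : 1 + -b / (a + b) = a / (a + b) := by field_simp; ring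
      rw [h3, Real.div_rpow ha hpos.le, le_div_iff₀ (Real.rpow_pos_of_pos hpos q)] at h2
      have h4 : (1 + q * (-b / (a + b))) * (a + b) ^ q =
          (a + b) ^ q - q * ((a + b) ^ q / (a + b)) * b := by
        field_simp
        ring
      rw [h4, ← Real.rpow_sub_one hpos.ne'] at h2
      linarith
  refine h1.trans ?_
  have h5 : (a + b) ^ (q - 1) ≤ N ^ (q - 1) :=
    Real.rpow_le_rpow (add_nonneg ha hb) hN (by linarith)
  gcongr

theorem distSq_le (r s : ℝ) (hr : 0 ≤ r) : distSq r s ≤ (1 + r) ^ 2 := by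
  rw [distSq]
  nlinarith [Real.cos_le_one s]

theorem distSq_rpow_half_le {A r : ℝ} (hA : 0 ≤ A) (hr : 0 ≤ r) (s : ℝ) :
    distSq r s ^ (A / 2) ≤ (1 + r) ^ A := by
  have h1 : (1 + r) ^ A = ((1 + r) ^ 2) ^ (A / 2) := by
    rw [← Real.rpow_natCast, ← Real.rpow_mul (by positivity)]
    congr 1
    norm_num
    ring
  rw [h1]
  exact Real.rpow_le_rpow (distSq_nonneg r s) (distSq_le r s hr) (by positivity)

theorem continuous_distSq_rpow {r : ℝ} (hr : 0 ≤ r) (hr1 : r < 1) (κ : ℝ) :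
    Continuous fun s => distSq r s ^ κ := by
  have hc : Continuous fun s => distSq r s := by unfold distSq; fun_prop
  exact hc.rpow_const fun s => Or.inl (distSq_pos hr hr1 _).ne'

theorem sharpConst_nonneg (α β : ℝ) (p : ℝ≥0∞) (r : ℝ) (x y : ℂ) :
    0 ≤ sharpConst α β p r x y := by
  have hJ : ∀ κ q : ℝ, 0 ≤ ∫ s in (0 : ℝ)..(2 * π), ‖trigPoly α β r x y s‖ ^ q * distSq r s ^ κ :=
    fun κ q => intervalIntegral.integral_nonneg Real.two_pi_pos.le fun s _ =>
      mul_nonneg (by positivity) (Real.rpow_nonneg (distSq_nonneg _ _) _)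
  unfold sharpConst
  split_ifs
  · exact mul_nonneg (abs_nonneg _) (Real.iSup_nonneg fun s =>
      mul_nonneg (norm_nonneg _) (Real.rpow_nonneg (distSq_nonneg _ _) _))
  · have := hJ (((α + β + 2) * conjExp p - 2) / 2) (conjExp p)
    positivity

theorem sharpConst_smul {p : ℝ≥0∞} (hp : 1 ≤ p) (α β r : ℝ) (t x y : ℂ) :
    sharpConst α β p r (t * x) (t * y) = ‖t‖ * sharpConst α β p r x y := by
  have ht : ∀ s, ‖trigPoly α β r (t * x) (t * y) s‖ = ‖t‖ * ‖trigPoly α β r x y s‖ := fun s => by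
    rw [← norm_mul]
    congr 1
    simp only [trigPoly]
    ring
  unfold sharpConst
  split_ifs with hp1
  · simp only [ht, mul_assoc]
    rw [← Real.mul_iSup_of_nonneg (norm_nonneg t)]
    ring
  · obtain ⟨hq, -, -⟩ := conjExp_holder hp hp1
    set q := conjExp p
    have hq0 : (0 : ℝ) < q := by linarith
    have hJ : 0 ≤ ∫ s in (0 : ℝ)..(2 * π), ‖trigPoly α β r x y s‖ ^ q *
        distSq r s ^ (((α + β + 2) * q - 2) / 2) :=
      intervalIntegral.integral_nonneg Real.two_pi_pos.le fun s _ =>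
        mul_nonneg (by positivity) (Real.rpow_nonneg (distSq_nonneg _ _) _)
    simp only [ht, Real.mul_rpow (norm_nonneg t) (norm_nonneg _), mul_assoc]
    rw [intervalIntegral.integral_const_mul, mul_left_comm (1 / (2 * π)),
      Real.mul_rpow (by positivity) (by positivity), ← Real.rpow_mul (norm_nonneg t),
      mul_one_div_cancel hq0.ne', Real.rpow_one]
    ring

/-- This produces the shape of $C$ and $D$: $a(s)$ holds the part of the triangle inequality kept
inside the integral, and $b$ is the term containing $r$, namely $|\alpha+\beta|r$ or
$|\beta-\alpha|r$. -/
theorem sharpConst_le_of_norm_le_add {p : ℝ≥0∞} (hp : 1 ≤ p) (hp1 : p ≠ 1) {α β r : ℝ}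
    (hr : 0 ≤ r) (hr1 : r < 1) {x y : ℂ} {a : ℝ → ℝ} {b N : ℝ} (ha : Continuous a)
    (ha0 : ∀ s, 0 ≤ a s) (hb : 0 ≤ b) (hN : ∀ s, a s + b ≤ N)
    (h : ∀ s, ‖trigPoly α β r x y s‖ ≤ a s + b) :
    sharpConst α β p r x y ≤ |normConst α β| * (1 / (2 * π) * (∫ s in (0 : ℝ)..(2 * π),
      a s ^ conjExp p * distSq r s ^ (((α + β + 2) * conjExp p - 2) / 2)) +
      conjExp p * N ^ (conjExp p - 1) * b / (2 * π) * ∫ s in (0 : ℝ)..(2 * π),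
        distSq r s ^ (((α + β + 2) * conjExp p - 2) / 2)) ^ (1 / conjExp p) := by
  obtain ⟨hq, -, -⟩ := conjExp_holder hp hp1
  rw [sharpConst, if_neg hp1]
  set q := conjExp p
  set κ := ((α + β + 2) * q - 2) / 2
  have hq0 : (0 : ℝ) < q := by linarith
  have hdc := continuous_distSq_rpow hr hr1 κ
  have hd0 : ∀ s, 0 ≤ distSq r s ^ κ := fun s => Real.rpow_nonneg (distSq_nonneg _ _) _
  have hac : Continuous fun s => a s ^ q := ha.rpow_const fun _ => Or.inr hq0.le
  have htc : Continuous fun s => ‖trigPoly α β r x y s‖ ^ q :=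
    (continuous_trigPoly α β r x y).norm.rpow_const fun _ => Or.inr hq0.le
  have hle : ∫ s in (0 : ℝ)..(2 * π), ‖trigPoly α β r x y s‖ ^ q * distSq r s ^ κ ≤
      (∫ s in (0 : ℝ)..(2 * π), a s ^ q * distSq r s ^ κ) +
        q * N ^ (q - 1) * b * ∫ s in (0 : ℝ)..(2 * π), distSq r s ^ κ := by
    have i1 : IntervalIntegrable (fun s => a s ^ q * distSq r s ^ κ) volume 0 (2 * π) :=
      (hac.mul hdc).intervalIntegrable _ _
    have i2 : IntervalIntegrable (fun s => q * N ^ (q - 1) * b * distSq r s ^ κ) volume 0 (2 * π) :=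
      (continuous_const.mul hdc).intervalIntegrable _ _
    rw [← intervalIntegral.integral_const_mul, ← intervalIntegral.integral_add i1 i2]
    refine intervalIntegral.integral_mono_on Real.two_pi_pos.le
      ((htc.mul hdc).intervalIntegrable _ _) (i1.add i2) fun s _ => ?_
    rw [← add_mul]
    exact mul_le_mul_of_nonneg_right ((Real.rpow_le_rpow (norm_nonneg _) (h s) hq0.le).trans
      (rpow_add_le (ha0 s) hb (hN s) hq)) (hd0 s)
  have hJ : 0 ≤ ∫ s in (0 : ℝ)..(2 * π), ‖trigPoly α β r x y s‖ ^ q * distSq r s ^ κ :=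
    intervalIntegral.integral_nonneg Real.two_pi_pos.le fun s _ =>
      mul_nonneg (by positivity) (hd0 s)
  refine mul_le_mul_of_nonneg_left (Real.rpow_le_rpow (by positivity) ?_ (by positivity))
    (abs_nonneg _)
  calc _ ≤ 1 / (2 * π) * ((∫ s in (0 : ℝ)..(2 * π), a s ^ q * distSq r s ^ κ) +
        q * N ^ (q - 1) * b * ∫ s in (0 : ℝ)..(2 * π), distSq r s ^ κ) := by gcongr
    _ = _ := by ring

theorem sharpConst_one_le {α β r : ℝ} (hA : 0 ≤ α + β + 2) (hr : 0 ≤ r) {x y : ℂ} {a : ℝ}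
    (h : ∀ s, ‖trigPoly α β r x y s‖ ≤ a) :
    sharpConst α β 1 r x y ≤ |normConst α β| * (a * (1 + r) ^ (α + β + 2)) := by
  rw [sharpConst, if_pos rfl]
  refine mul_le_mul_of_nonneg_left (ciSup_le fun s => ?_) (abs_nonneg _)
  exact mul_le_mul (h s) (distSq_rpow_half_le hA hr s) (Real.rpow_nonneg (distSq_nonneg _ _) _)
    ((norm_nonneg _).trans (h s))

theorem I11_eq (α β q r : ℝ) : I11 α β q r = ∫ s in (0 : ℝ)..(2 * π),
    (|(α + β + 2) * Real.cos s| + |α - β|) ^ q * distSq r s ^ (((α + β + 2) * q - 2) / 2) := rfl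

theorem I12_eq (α β q r : ℝ) : I12 α β q r = ∫ s in (0 : ℝ)..(2 * π),
    distSq r s ^ (((α + β + 2) * q - 2) / 2) := rfl

theorem I13_eq (α β q r : ℝ) : I13 α β q r = ∫ s in (0 : ℝ)..(2 * π),
    (|β - α| + |(α + β + 2) * Real.sin s|) ^ q * distSq r s ^ (((α + β + 2) * q - 2) / 2) := rfl

theorem unit_re_im (s : ℝ) : unit (s : T) = Real.cos s + Real.sin s * Complex.I := by
  rw [unit_coe, Complex.exp_mul_I, Complex.ofReal_cos, Complex.ofReal_sin]

theorem trigPoly_one_one (α β r s : ℝ) : trigPoly α β r 1 1 s =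
    (((α + β + 2) * Real.cos s : ℝ) : ℂ) + (((α - β) * Real.sin s : ℝ) : ℂ) * Complex.I -
      (((α + β) * r : ℝ) : ℂ) := by
  simp only [trigPoly, unit_re_im, map_add, map_mul, Complex.conj_ofReal, Complex.conj_I]
  push_cast
  ring

theorem trigPoly_one_neg_one (α β r s : ℝ) : trigPoly α β r 1 (-1) s =
    (((α - β) * Real.cos s : ℝ) : ℂ) + (((α + β + 2) * Real.sin s : ℝ) : ℂ) * Complex.I +
      (((α - β) * r : ℝ) : ℂ) := by
  simp only [trigPoly, unit_re_im, map_add, map_mul, Complex.conj_ofReal, Complex.conj_I]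
  push_cast
  ring

/-- An identity rather than an estimate. It is the source of sharpness for $u_\theta$ when
$\alpha=\beta$. -/
theorem norm_trigPoly_self (α r s : ℝ) :
    ‖trigPoly α α r 1 (-1) s‖ = |(α + α + 2) * Real.sin s| := by
  rw [trigPoly_one_neg_one, sub_self, zero_mul, zero_mul, Complex.ofReal_zero, zero_add, add_zero,
    norm_mul, Complex.norm_I, mul_one, Complex.norm_real, Real.norm_eq_abs]

theorem norm_trigPoly_one_one_le (α β : ℝ) {r : ℝ} (hr : 0 ≤ r) (s : ℝ) :
    ‖trigPoly α β r 1 1 s‖ ≤ |(α + β + 2) * Real.cos s| + |α - β| + |α + β| * r := by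
  rw [trigPoly_one_one]
  refine (norm_sub_le _ _).trans (add_le_add ((norm_add_le _ _).trans (add_le_add ?_ ?_)) ?_)
  · rw [Complex.norm_real, Real.norm_eq_abs]
  · rw [norm_mul, Complex.norm_I, mul_one, Complex.norm_real, Real.norm_eq_abs, abs_mul]
    exact mul_le_of_le_one_right (abs_nonneg _) (Real.abs_sin_le_one s)
  · rw [Complex.norm_real, Real.norm_eq_abs, abs_mul, abs_of_nonneg hr]

theorem norm_trigPoly_one_neg_one_le (α β : ℝ) {r : ℝ} (hr : 0 ≤ r) (s : ℝ) :
    ‖trigPoly α β r 1 (-1) s‖ ≤ |β - α| + |(α + β + 2) * Real.sin s| + |β - α| * r := by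
  rw [trigPoly_one_neg_one, abs_sub_comm β α]
  refine (norm_add_le _ _).trans (add_le_add ((norm_add_le _ _).trans (add_le_add ?_ ?_)) ?_)
  · rw [Complex.norm_real, Real.norm_eq_abs, abs_mul]
    exact mul_le_of_le_one_right (abs_nonneg _) (Real.abs_cos_le_one s)
  · rw [norm_mul, Complex.norm_I, mul_one, Complex.norm_real, Real.norm_eq_abs]
  · rw [Complex.norm_real, Real.norm_eq_abs, abs_mul, abs_of_nonneg hr]

theorem norm_trigPoly_one_zero_le (α β : ℝ) {r : ℝ} (hr : 0 ≤ r) (s : ℝ) :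
    ‖trigPoly α β r 1 0 s‖ ≤ |α + 1| + |β| * r := by
  have h1 : trigPoly α β r 1 0 s = ((α + 1 : ℝ) : ℂ) * unit (s : T) - ((β * r : ℝ) : ℂ) := by
    simp [trigPoly]
  rw [h1]
  refine (norm_sub_le _ _).trans (add_le_add ?_ ?_)
  · rw [norm_mul, norm_unit, mul_one, Complex.norm_real, Real.norm_eq_abs]
  · rw [Complex.norm_real, Real.norm_eq_abs, abs_mul, abs_of_nonneg hr]

theorem norm_trigPoly_zero_one_le (α β : ℝ) {r : ℝ} (hr : 0 ≤ r) (s : ℝ) :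
    ‖trigPoly α β r 0 1 s‖ ≤ |β + 1| + |α| * r := by
  have h1 : trigPoly α β r 0 1 s =
      ((β + 1 : ℝ) : ℂ) * conj (unit (s : T)) - ((α * r : ℝ) : ℂ) := by
    simp [trigPoly]
  rw [h1]
  refine (norm_sub_le _ _).trans (add_le_add ?_ ?_)
  · rw [norm_mul, Complex.norm_conj, norm_unit, mul_one, Complex.norm_real, Real.norm_eq_abs]
  · rw [Complex.norm_real, Real.norm_eq_abs, abs_mul, abs_of_nonneg hr]

theorem abs_mul_cos_le (A s : ℝ) : |A * Real.cos s| ≤ |A| := by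
  rw [abs_mul]
  exact mul_le_of_le_one_right (abs_nonneg _) (Real.abs_cos_le_one s)

theorem abs_mul_sin_le (A s : ℝ) : |A * Real.sin s| ≤ |A| := by
  rw [abs_mul]
  exact mul_le_of_le_one_right (abs_nonneg _) (Real.abs_sin_le_one s)

theorem sharpConst_le_Cfun {p : ℝ≥0∞} (hp : 1 ≤ p) {α β r : ℝ} (h : Admissible α β)
    (hr : 0 ≤ r) (hr1 : r < 1) : sharpConst α β p r 1 1 ≤ Cfun α β p r := by
  have hA : 0 ≤ α + β + 2 := by linarith [h.sum]
  have hN : ∀ s, |(α + β + 2) * Real.cos s| + |α - β| + |α + β| * r ≤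
      |α + β| * r + |α + β + 2| + |α - β| := fun s => by
    linarith [abs_mul_cos_le (α + β + 2) s]
  by_cases hp1 : p = 1
  · subst hp1
    rw [Cfun, if_pos rfl]
    exact sharpConst_one_le hA hr fun s => (norm_trigPoly_one_one_le α β hr s).trans (hN s)
  · rw [Cfun, if_neg hp1]
    simp only
    rw [I11_eq, I12_eq]
    refine (sharpConst_le_of_norm_le_add hp hp1 hr hr1 (by fun_prop) (fun s => by positivity)
      (by positivity) hN (norm_trigPoly_one_one_le α β hr)).trans (le_of_eq ?_)
    congr 3
    ring

theorem sharpConst_le_Dfun {p : ℝ≥0∞} (hp : 1 ≤ p) {α β r : ℝ} (h : Admissible α β)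
    (hr : 0 ≤ r) (hr1 : r < 1) :
    sharpConst α β p r (Complex.I * r) (-(Complex.I * r)) ≤ Dfun α β p r := by
  have hA : 0 ≤ α + β + 2 := by linarith [h.sum]
  have hN : ∀ s, |β - α| + |(α + β + 2) * Real.sin s| + |β - α| * r ≤
      |β - α| + |α + β + 2| + |β - α| * r := fun s => by
    linarith [abs_mul_sin_le (α + β + 2) s]
  -- The pair $(ir,-ir)$ is $ir$ times $(1,-1)$, which gives the outer factor $r$ in $D$.
  have hsm := sharpConst_smul hp α β r (Complex.I * r) 1 (-1)
  rw [mul_one, mul_neg, mul_one, norm_mul, Complex.norm_I, one_mul, Complex.norm_real,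
    Real.norm_of_nonneg hr] at hsm
  rw [hsm]
  by_cases hp1 : p = 1
  · subst hp1
    rw [Dfun, if_pos rfl]
    split_ifs with hαβ
    · subst hαβ
      rw [sharpConst, if_pos rfl, mul_left_comm, ← mul_assoc]
      refine le_of_eq ?_
      congr 2
      ext s
      rw [norm_trigPoly_self, distSq]
    · refine (mul_le_mul_of_nonneg_left (sharpConst_one_le hA hr fun s =>
        (norm_trigPoly_one_neg_one_le α β hr s).trans (hN s)) hr).trans (le_of_eq ?_)
      ring
  · rw [Dfun, if_neg hp1]
    simp only
    rw [I13_eq, I12_eq, mul_comm |normConst α β| r, mul_assoc r]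
    refine mul_le_mul_of_nonneg_left ?_ hr
    refine (sharpConst_le_of_norm_le_add hp hp1 hr hr1 (by fun_prop) (fun s => by positivity)
      (by positivity) hN (norm_trigPoly_one_neg_one_le α β hr)).trans (le_of_eq ?_)
    congr 3
    ring

/-- A majorant constant in $s$ leaves the integral altogether, so the correction term is absent
($b=0$). This is the form of $E$. -/
theorem sharpConst_le_const {p : ℝ≥0∞} (hp : 1 ≤ p) {α β r : ℝ} (h : Admissible α β)
    (hr : 0 ≤ r) (hr1 : r < 1) {x y : ℂ} {a : ℝ} (ha : ∀ s, ‖trigPoly α β r x y s‖ ≤ a) :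
    sharpConst α β p r x y ≤ if p = 1 then |normConst α β| * a * (1 + r) ^ (α + β + 2) else
      |normConst α β| * a * (1 / (2 * π) * I12 α β (conjExp p) r) ^ (1 / conjExp p) := by
  have hA : 0 ≤ α + β + 2 := by linarith [h.sum]
  have ha0 : 0 ≤ a := (norm_nonneg _).trans (ha 0)
  split_ifs with hp1
  · subst hp1
    rw [mul_assoc]
    exact sharpConst_one_le hA hr ha
  · have h1 := sharpConst_le_of_norm_le_add hp hp1 hr hr1 (a := fun _ => a) (b := 0) (N := a)
      continuous_const (fun _ => ha0) le_rfl (fun _ => by simp) (by simpa using ha)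
    refine h1.trans (le_of_eq ?_)
    obtain ⟨hq, -, -⟩ := conjExp_holder hp hp1
    rw [I12_eq]
    set q := conjExp p
    have hq0 : (0 : ℝ) < q := by linarith
    have hJ : 0 ≤ ∫ s in (0 : ℝ)..(2 * π), distSq r s ^ (((α + β + 2) * q - 2) / 2) :=
      intervalIntegral.integral_nonneg Real.two_pi_pos.le fun s _ =>
        Real.rpow_nonneg (distSq_nonneg _ _) _
    rw [intervalIntegral.integral_const_mul, mul_zero, zero_div, zero_mul, add_zero,
      mul_left_comm (1 / (2 * π)), Real.mul_rpow (by positivity) (by positivity),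
      ← Real.rpow_mul ha0, mul_one_div_cancel hq0.ne', Real.rpow_one]
    ring

theorem sharpConst_one_zero_le_Efun {p : ℝ≥0∞} (hp : 1 ≤ p) {α β r : ℝ} (h : Admissible α β)
    (hr : 0 ≤ r) (hr1 : r < 1) : sharpConst α β p r 1 0 ≤ Efun α β p r :=
  sharpConst_le_const hp h hr hr1 (norm_trigPoly_one_zero_le α β hr)

theorem normConst_comm (α β : ℝ) : normConst α β = normConst β α := by
  rw [normConst, normConst, add_comm α β, mul_comm]

theorem sharpConst_zero_one_le_Efun {p : ℝ≥0∞} (hp : 1 ≤ p) {α β r : ℝ} (h : Admissible α β)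
    (hr : 0 ≤ r) (hr1 : r < 1) : sharpConst α β p r 0 1 ≤ Efun β α p r := by
  have h1 := sharpConst_le_const hp h hr hr1 (norm_trigPoly_zero_one_le α β hr)
  rw [normConst_comm, I12, add_comm α β] at h1
  exact h1

theorem sharpConst_conj_unit {p : ℝ≥0∞} (hp : 1 ≤ p) (α β r : ℝ) (τ : T) :
    sharpConst α β p r (conj (unit τ)) 0 = sharpConst α β p r 1 0 := by
  have h := sharpConst_smul hp α β r (conj (unit τ)) 1 0
  rwa [mul_one, mul_zero, Complex.norm_conj, norm_unit, one_mul] at h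

theorem sharpConst_unit {p : ℝ≥0∞} (hp : 1 ≤ p) (α β r : ℝ) (τ : T) :
    sharpConst α β p r 0 (unit τ) = sharpConst α β p r 0 1 := by
  have h := sharpConst_smul hp α β r (unit τ) 0 1
  rwa [mul_one, mul_zero, norm_unit, one_mul] at h

/-! ### Cases in which the upper bounds are exact -/

theorem Dfun_self_le_sharpConst {p : ℝ≥0∞} (hp : 1 ≤ p) (α : ℝ) {r : ℝ} (hr : 0 ≤ r) :
    Dfun α α p r ≤ sharpConst α α p r (Complex.I * r) (-(Complex.I * r)) := by
  have hsm := sharpConst_smul hp α α r (Complex.I * r) 1 (-1)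
  rw [mul_one, mul_neg, mul_one, norm_mul, Complex.norm_I, one_mul, Complex.norm_real,
    Real.norm_of_nonneg hr] at hsm
  rw [hsm]
  have ht := norm_trigPoly_self α r
  by_cases hp1 : p = 1
  · subst hp1
    rw [Dfun, if_pos rfl, if_pos rfl, sharpConst, if_pos rfl, mul_left_comm, ← mul_assoc]
    simp only [ht, distSq, le_refl]
  · rw [Dfun, if_neg hp1, sharpConst, if_neg hp1]
    simp only [ht, sub_self, abs_zero, zero_mul, mul_zero, zero_div, add_zero, I13_eq, zero_add]
    exact le_of_eq (by ring)

theorem admissible_zero : Admissible 0 0 where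
  left n h := by
    have : (0 : ℝ) ≤ n := n.cast_nonneg
    linarith
  right n h := by
    have : (0 : ℝ) ≤ n := n.cast_nonneg
    linarith
  sum := by norm_num

/-- At $s=0$ the quantity `distSq r s` takes its maximal value $(1+r)^2$. At $\alpha=\beta=0$ the
relevant polynomials $2\cos s$ and $e^{\pm is}$ have maximal modulus there as well, so for $p=1$ the
product of the suprema is attained. -/
theorem le_sharpConst_one {α β r : ℝ} (h : Admissible α β) (hr : 0 ≤ r) (hr1 : r < 1) (x y : ℂ) :
    |normConst α β| * (‖trigPoly α β r x y 0‖ * (1 + r) ^ (α + β + 2)) ≤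
      sharpConst α β 1 r x y := by
  rw [sharpConst, if_pos rfl]
  refine mul_le_mul_of_nonneg_left ?_ (abs_nonneg _)
  refine le_trans (le_of_eq ?_) (le_ciSup (bddAbove_trigPoly h hr hr1 x y) 0)
  have h1 : distSq r 0 = (1 + r) ^ 2 := by
    rw [distSq, Real.cos_zero]
    ring
  rw [h1, ← Real.rpow_natCast (1 + r), ← Real.rpow_mul (by positivity)]
  congr 2
  norm_num
  ring

theorem Cfun_zero_le_sharpConst {p : ℝ≥0∞} {r : ℝ} (hr : 0 ≤ r) (hr1 : r < 1) :
    Cfun 0 0 p r ≤ sharpConst 0 0 p r 1 1 := by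
  have ht : ∀ s, ‖trigPoly 0 0 r 1 1 s‖ = |(0 + 0 + 2) * Real.cos s| := fun s => by
    rw [trigPoly_one_one, sub_self, zero_mul, Complex.ofReal_zero, zero_mul, add_zero, zero_add,
      zero_mul, Complex.ofReal_zero, sub_zero, Complex.norm_real, Real.norm_eq_abs]
  by_cases hp1 : p = 1
  · subst hp1
    refine le_trans (le_of_eq ?_) (le_sharpConst_one admissible_zero hr hr1 1 1)
    rw [Cfun, if_pos rfl, ht]
    simp
  · rw [Cfun, if_neg hp1, sharpConst, if_neg hp1]
    simp only [ht, sub_self, abs_zero, zero_mul, mul_zero, zero_div, add_zero, I11_eq]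
    exact le_rfl

theorem Efun_zero_le_sharpConst {p : ℝ≥0∞} {r : ℝ} (hr : 0 ≤ r) (hr1 : r < 1) {x y : ℂ}
    (ht : ∀ s, ‖trigPoly 0 0 r x y s‖ = 1) :
    Efun 0 0 p r ≤ sharpConst 0 0 p r x y := by
  by_cases hp1 : p = 1
  · subst hp1
    refine le_trans (le_of_eq ?_) (le_sharpConst_one admissible_zero hr hr1 x y)
    rw [Efun, if_pos rfl, ht]
    simp
  · rw [Efun, if_neg hp1, sharpConst, if_neg hp1]
    simp only [ht, I12_eq, Real.one_rpow, one_mul, zero_add, abs_one, abs_zero, zero_mul, add_zero,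
      mul_one]
    exact le_rfl

theorem norm_trigPoly_zero_one_zero (r s : ℝ) : ‖trigPoly 0 0 r 1 0 s‖ = 1 := by
  simp [trigPoly, norm_unit]

theorem norm_trigPoly_zero_zero_one (r s : ℝ) : ‖trigPoly 0 0 r 0 1 s‖ = 1 := by
  simp [trigPoly, norm_unit]

/-! ### Continuity up to the boundary and the closed form of $E$ -/

/-- Since $A=\alpha+\beta+2>1$ and $q\ge1$, one has $Aq>1$. This is where $\alpha+\beta>-1$ makes
the singularity at $r=1$ integrable. -/
theorem neg_half_lt_exponent {α β q : ℝ} (h : Admissible α β) (hq : 1 ≤ q) :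
    -(1 / 2) < ((α + β + 2) * q - 2) / 2 := by
  nlinarith [h.sum]

theorem continuousAt_integral_mul_distSq {q : ℝ} (hq : 1 ≤ q) {g : (ℝ × ℝ) × ℝ → ℝ → ℝ}
    (hg : Continuous (Function.uncurry g)) {x : (ℝ × ℝ) × ℝ} (hx : Admissible x.1.1 x.1.2) :
    ContinuousAt (fun x : (ℝ × ℝ) × ℝ => ∫ s in (0 : ℝ)..(2 * π),
      g x s * distSq x.2 s ^ (((x.1.1 + x.1.2 + 2) * q - 2) / 2)) x :=
  continuousAt_integral_distSq hg (κ := fun x => ((x.1.1 + x.1.2 + 2) * q - 2) / 2)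
    (ρ := fun x => x.2) (by fun_prop) (by fun_prop) (neg_half_lt_exponent hx hq)

theorem continuousAt_I11 {q : ℝ} (hq : 1 ≤ q) {x : (ℝ × ℝ) × ℝ} (hx : Admissible x.1.1 x.1.2) :
    ContinuousAt (fun x : (ℝ × ℝ) × ℝ => I11 x.1.1 x.1.2 q x.2) x := by
  refine continuousAt_integral_mul_distSq hq (g := fun x s =>
    (|(x.1.1 + x.1.2 + 2) * Real.cos s| + |x.1.1 - x.1.2|) ^ q) ?_ hx
  exact Continuous.rpow_const (by fun_prop) fun _ => Or.inr (by linarith)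

theorem continuousAt_I12 {q : ℝ} (hq : 1 ≤ q) {x : (ℝ × ℝ) × ℝ} (hx : Admissible x.1.1 x.1.2) :
    ContinuousAt (fun x : (ℝ × ℝ) × ℝ => I12 x.1.1 x.1.2 q x.2) x := by
  have := continuousAt_integral_mul_distSq hq (g := fun _ _ => 1) continuous_const hx
  simp only [one_mul] at this
  exact this

theorem continuousAt_I13 {q : ℝ} (hq : 1 ≤ q) {x : (ℝ × ℝ) × ℝ} (hx : Admissible x.1.1 x.1.2) :
    ContinuousAt (fun x : (ℝ × ℝ) × ℝ => I13 x.1.1 x.1.2 q x.2) x := by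
  refine continuousAt_integral_mul_distSq hq (g := fun x s =>
    (|x.1.2 - x.1.1| + |(x.1.1 + x.1.2 + 2) * Real.sin s|) ^ q) ?_ hx
  exact Continuous.rpow_const (by fun_prop) fun _ => Or.inr (by linarith)

theorem continuousOn_abs_normConst :
    ContinuousOn (fun x : (ℝ × ℝ) × ℝ => |normConst x.1.1 x.1.2|)
      ({x | Admissible x.1 x.2} ×ˢ Icc 0 1) :=
  (continuousOn_normConst.comp continuousOn_fst fun _ hx => hx.1).abs

theorem continuousOn_one_add_rpow :
    ContinuousOn (fun x : (ℝ × ℝ) × ℝ => (1 + x.2) ^ (x.1.1 + x.1.2 + 2))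
      ({x | Admissible x.1 x.2} ×ˢ Icc 0 1) :=
  ContinuousOn.rpow (by fun_prop) (by fun_prop) fun x hx => Or.inl (by linarith [hx.2.1])

theorem continuousOn_Cfun {p : ℝ≥0∞} (hp : 1 ≤ p) :
    ContinuousOn (Function.uncurry fun (x : ℝ × ℝ) r => Cfun x.1 x.2 p r)
      ({x | Admissible x.1 x.2} ×ˢ Icc 0 1) := by
  unfold Cfun Function.uncurry
  by_cases hp1 : p = 1
  · simp only [if_pos hp1]
    exact continuousOn_abs_normConst.mul (ContinuousOn.mul (by fun_prop) continuousOn_one_add_rpow)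
  · simp only [if_neg hp1]
    obtain ⟨hq, -, -⟩ := conjExp_holder hp hp1
    have h1 : ContinuousOn (fun x : (ℝ × ℝ) × ℝ => I11 x.1.1 x.1.2 (conjExp p) x.2)
      ({x | Admissible x.1 x.2} ×ˢ Icc 0 1) := fun x hx =>
        (continuousAt_I11 hq hx.1).continuousWithinAt
    have h2 : ContinuousOn (fun x : (ℝ × ℝ) × ℝ => I12 x.1.1 x.1.2 (conjExp p) x.2)
      ({x | Admissible x.1 x.2} ×ˢ Icc 0 1) := fun x hx =>
        (continuousAt_I12 hq hx.1).continuousWithinAt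
    have h3 : Continuous fun x : (ℝ × ℝ) × ℝ =>
        (|x.1.1 + x.1.2| * x.2 + |x.1.1 + x.1.2 + 2| + |x.1.1 - x.1.2|) ^ (conjExp p - 1) :=
      Continuous.rpow_const (by fun_prop) fun _ => Or.inr (by linarith)
    refine continuousOn_abs_normConst.mul (ContinuousOn.rpow_const ?_ fun _ _ => Or.inr (by positivity))
    refine (continuousOn_const.mul h1).add (ContinuousOn.mul ?_ h2)
    fun_prop

/-- The case $p=1$ is excluded because the two branches of $D_{\alpha,\beta,1}$ do not match as
$\alpha-\beta\to0$: $|\sin s|$ vanishes where the weight is largest, so the supremum of the product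
is smaller than the product of the suprema. -/
theorem continuousOn_Dfun {p : ℝ≥0∞} (hp : 1 ≤ p) (hp1 : p ≠ 1) :
    ContinuousOn (Function.uncurry fun (x : ℝ × ℝ) r => Dfun x.1 x.2 p r)
      ({x | Admissible x.1 x.2} ×ˢ Icc 0 1) := by
  unfold Dfun Function.uncurry
  simp only [if_neg hp1]
  obtain ⟨hq, -, -⟩ := conjExp_holder hp hp1
  have h1 : ContinuousOn (fun x : (ℝ × ℝ) × ℝ => I13 x.1.1 x.1.2 (conjExp p) x.2)
    ({x | Admissible x.1 x.2} ×ˢ Icc 0 1) := fun x hx =>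
      (continuousAt_I13 hq hx.1).continuousWithinAt
  have h2 : ContinuousOn (fun x : (ℝ × ℝ) × ℝ => I12 x.1.1 x.1.2 (conjExp p) x.2)
    ({x | Admissible x.1 x.2} ×ˢ Icc 0 1) := fun x hx =>
      (continuousAt_I12 hq hx.1).continuousWithinAt
  have h3 : Continuous fun x : (ℝ × ℝ) × ℝ =>
      (|x.1.2 - x.1.1| + |x.1.1 + x.1.2 + 2| + |x.1.2 - x.1.1| * x.2) ^ (conjExp p - 1) :=
    Continuous.rpow_const (by fun_prop) fun _ => Or.inr (by linarith)
  refine (continuousOn_abs_normConst.mul continuousOn_snd).mul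
    (ContinuousOn.rpow_const ?_ fun _ _ => Or.inr (by positivity))
  refine (continuousOn_const.mul h1).add (ContinuousOn.mul ?_ h2)
  fun_prop

theorem continuousOn_Efun {p : ℝ≥0∞} (hp : 1 ≤ p) :
    ContinuousOn (Function.uncurry fun (x : ℝ × ℝ) r => Efun x.1 x.2 p r)
      ({x | Admissible x.1 x.2} ×ˢ Icc 0 1) := by
  unfold Efun Function.uncurry
  by_cases hp1 : p = 1
  · simp only [if_pos hp1]
    exact (continuousOn_abs_normConst.mul (by fun_prop)).mul continuousOn_one_add_rpow
  · simp only [if_neg hp1]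
    obtain ⟨hq, -, -⟩ := conjExp_holder hp hp1
    have h2 : ContinuousOn (fun x : (ℝ × ℝ) × ℝ => I12 x.1.1 x.1.2 (conjExp p) x.2)
      ({x | Admissible x.1 x.2} ×ˢ Icc 0 1) := fun x hx =>
        (continuousAt_I12 hq hx.1).continuousWithinAt
    exact (continuousOn_abs_normConst.mul (by fun_prop)).mul
      ((continuousOn_const.mul h2).rpow_const fun _ _ => Or.inr (by positivity))

theorem continuousOn_slice {F : ℝ × ℝ → ℝ → ℝ} {S : Set (ℝ × ℝ)}
    (hF : ContinuousOn (Function.uncurry F) (S ×ˢ Icc 0 1)) {x : ℝ × ℝ} (hx : x ∈ S) :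
    ContinuousOn (F x) (Icc 0 1) :=
  hF.comp (f := fun r : ℝ => (x, r)) (by fun_prop) fun _ hr => ⟨hx, hr⟩

theorem le_sSup_image_Ioo {F : ℝ → ℝ} (hF : ContinuousOn F (Icc 0 1)) {r : ℝ} (hr : r ∈ Icc 0 1) :
    F r ≤ sSup (F '' Ioo 0 1) := by
  rw [(isLUB_image_Ioo hF).2]
  exact le_csSup (isCompact_Icc.image_of_continuousOn hF).bddAbove (mem_image_of_mem F hr)

theorem continuousOn_Cfun_slice {p : ℝ≥0∞} (hp : 1 ≤ p) {α β : ℝ} (h : Admissible α β) :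
    ContinuousOn (Cfun α β p) (Icc 0 1) :=
  continuousOn_slice (continuousOn_Cfun hp) (x := (α, β)) h

theorem continuousOn_Efun_slice {p : ℝ≥0∞} (hp : 1 ≤ p) {α β : ℝ} (h : Admissible α β) :
    ContinuousOn (Efun α β p) (Icc 0 1) :=
  continuousOn_slice (continuousOn_Efun hp) (x := (α, β)) h

theorem bddAbove_Dfun {p : ℝ≥0∞} (hp : 1 ≤ p) {α β : ℝ} (h : Admissible α β) :
    BddAbove (Dfun α β p '' Ioo 0 1) := by
  by_cases hp1 : p = 1
  · subst hp1
    have hA : 0 ≤ α + β + 2 := by linarith [h.sum]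
    -- For $p=1$ an explicit bound replaces continuity: the value at $r=1$ of the formula for
    -- $\alpha\ne\beta$ dominates both branches.
    refine ⟨|normConst α β| * 1 * ((|β - α| + |α + β + 2| + |β - α| * 1) * 2 ^ (α + β + 2)), ?_⟩
    rintro _ ⟨r, hr, rfl⟩
    have hr0 := hr.1.le
    have h2 : (1 + r) ^ (α + β + 2) ≤ 2 ^ (α + β + 2) :=
      Real.rpow_le_rpow (by linarith) (by linarith [hr.2]) hA
    have h3 : 0 ≤ (1 + r) ^ (α + β + 2) := Real.rpow_nonneg (by linarith) _
    rw [Dfun, if_pos rfl]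
    split_ifs
    · refine mul_le_mul (mul_le_mul_of_nonneg_left hr.2.le (abs_nonneg _)) (ciSup_le fun s => ?_)
        (Real.iSup_nonneg fun s => mul_nonneg (abs_nonneg _)
          (Real.rpow_nonneg (distSq_nonneg r s) _)) (by positivity)
      refine mul_le_mul ((abs_mul_sin_le _ s).trans ?_) ((distSq_rpow_half_le hA hr0 s).trans h2)
        (Real.rpow_nonneg (distSq_nonneg r s) _) (by positivity)
      linarith [abs_nonneg (β - α)]
    · have := hr.2.le
      gcongr
  · have hc : ContinuousOn (Dfun α β p) (Icc 0 1) :=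
      continuousOn_slice (continuousOn_Dfun hp hp1) (x := (α, β)) h
    exact (isCompact_Icc.image_of_continuousOn hc).bddAbove.mono (image_mono Ioo_subset_Icc_self)

theorem nonempty_image_Ioo (F : ℝ → ℝ) : (F '' Ioo (0 : ℝ) 1).Nonempty :=
  (nonempty_Ioo.2 zero_lt_one).image F

theorem Dfun_zero (α β : ℝ) (p : ℝ≥0∞) : Dfun α β p 0 = 0 := by
  unfold Dfun
  split_ifs <;> simp

theorem Dfun_le_Dconst {p : ℝ≥0∞} (hp : 1 ≤ p) {α β r : ℝ} (h : Admissible α β) (hr : 0 ≤ r)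
    (hr1 : r < 1) : Dfun α β p r ≤ Dconst α β p := by
  have hle : ∀ ρ ∈ Ioo (0 : ℝ) 1, Dfun α β p ρ ≤ Dconst α β p := fun ρ hρ =>
    le_csSup (bddAbove_Dfun hp h) (mem_image_of_mem _ hρ)
  rcases hr.eq_or_lt with rfl | hpos
  -- The radius $0$ is not in the range of the supremum. There $D$ vanishes, and the supremum is
  -- nonnegative since it dominates the exact constant at $r=\tfrac12$.
  · rw [Dfun_zero]
    have h1 := sharpConst_le_Dfun hp h (r := 1 / 2) (by norm_num) (by norm_num)
    exact (sharpConst_nonneg _ _ _ _ _ _).trans (h1.trans (hle _ (by constructor <;> norm_num)))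
  · exact hle r ⟨hpos, hr1⟩

theorem Efun_one {p : ℝ≥0∞} (hp : 1 ≤ p) {α β : ℝ} (h : Admissible α β) :
    Efun α β p 1 = Eclosed α β p := by
  unfold Efun Eclosed
  split_ifs with hp1
  · norm_num
  · obtain ⟨hq, -, -⟩ := conjExp_holder hp hp1
    simp only
    rw [I12_eq, integral_distSq_one (neg_half_lt_exponent h hq), mul_one]
    congr 4
    · ring
    · congr 2
      ring

theorem Efun_le_Efun_one {p : ℝ≥0∞} (hp : 1 ≤ p) {α β r : ℝ} (h : Admissible α β) (hr : 0 ≤ r)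
    (hr1 : r ≤ 1) : Efun α β p r ≤ Efun α β p 1 := by
  rcases hr1.eq_or_lt with rfl | hlt
  · exact le_rfl
  have hA : 0 ≤ α + β + 2 := by linarith [h.sum]
  unfold Efun
  split_ifs with hp1
  · gcongr
  · obtain ⟨hq, -, -⟩ := conjExp_holder hp hp1
    simp only
    have h1 : I12 α β (conjExp p) r ≤ I12 α β (conjExp p) 1 :=
      integral_distSq_le_one (neg_half_lt_exponent h hq) hr hlt
    have h0 : 0 ≤ I12 α β (conjExp p) r :=
      intervalIntegral.integral_nonneg Real.two_pi_pos.le fun s _ =>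
        Real.rpow_nonneg (distSq_nonneg r s) _
    gcongr

theorem Econst_eq_Eclosed {p : ℝ≥0∞} (hp : 1 ≤ p) {α β : ℝ} (h : Admissible α β) :
    Econst α β p = Eclosed α β p := by
  rw [Econst, (isLUB_image_Ioo (continuousOn_Efun_slice hp h)).2, ← Efun_one hp h]
  refine IsGreatest.csSup_eq ⟨mem_image_of_mem _ (right_mem_Icc.2 zero_le_one), ?_⟩
  rintro _ ⟨r, hr, rfl⟩
  exact Efun_le_Efun_one hp h hr.1 hr.2

/-! ### Pointwise bounds and best constants -/

theorem lpNorm_nonneg (p : ℝ≥0∞) (f : T → ℂ) : 0 ≤ lpNorm p f := ENNReal.toReal_nonneg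

theorem div_weight_mul_lpNorm_le (p : ℝ≥0∞) {r a b : ℝ} (hr : 0 ≤ r) (hr1 : r < 1) (f : T → ℂ)
    (hab : a ≤ b) : a / weight p r * lpNorm p f ≤ b / weight p r * lpNorm p f :=
  mul_le_mul_of_nonneg_right (div_le_div_of_nonneg_right hab (weight_pos p hr hr1).le)
    (lpNorm_nonneg p f)

theorem Admissible.symm {α β : ℝ} (h : Admissible α β) : Admissible β α :=
  ⟨h.right, h.left, by linarith [h.sum]⟩

theorem norm_dR_le {p : ℝ≥0∞} (hp : 1 ≤ p) {α β : ℝ} (h : Admissible α β) {f : T → ℂ}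
    (hf : MemLp f p m) {r : ℝ} (θ : ℝ) (hr : 0 ≤ r) (hr1 : r < 1) :
    ‖dR (poissonIntegral α β f) r θ‖ ≤ Cfun α β p r / weight p r * lpNorm p f := by
  rw [dR_poissonIntegral h hr hr1 (hf.integrable hp)]
  exact (norm_polarIntegral_le hp h hr hr1 θ 1 1 hf).trans
    (div_weight_mul_lpNorm_le p hr hr1 f (sharpConst_le_Cfun hp h hr hr1))

theorem norm_dTheta_le {p : ℝ≥0∞} (hp : 1 ≤ p) {α β : ℝ} (h : Admissible α β) {f : T → ℂ}
    (hf : MemLp f p m) {r : ℝ} (θ : ℝ) (hr : 0 ≤ r) (hr1 : r < 1) :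
    ‖dTheta (poissonIntegral α β f) r θ‖ ≤ Dfun α β p r / weight p r * lpNorm p f := by
  rw [dTheta_poissonIntegral h hr hr1 (hf.integrable hp)]
  exact (norm_polarIntegral_le hp h hr hr1 θ _ _ hf).trans
    (div_weight_mul_lpNorm_le p hr hr1 f (sharpConst_le_Dfun hp h hr hr1))

theorem norm_dZ_le {p : ℝ≥0∞} (hp : 1 ≤ p) {α β : ℝ} (h : Admissible α β) {f : T → ℂ}
    (hf : MemLp f p m) {r : ℝ} (θ : ℝ) (hr : 0 ≤ r) (hr1 : r < 1) :
    ‖dZ (poissonIntegral α β f) (polar r θ)‖ ≤ Efun α β p r / weight p r * lpNorm p f := by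
  rw [dZ_poissonIntegral h hr hr1 (hf.integrable hp)]
  refine (norm_polarIntegral_le hp h hr hr1 θ _ _ hf).trans
    (div_weight_mul_lpNorm_le p hr hr1 f ?_)
  rw [sharpConst_conj_unit hp]
  exact sharpConst_one_zero_le_Efun hp h hr hr1

theorem norm_dZbar_le {p : ℝ≥0∞} (hp : 1 ≤ p) {α β : ℝ} (h : Admissible α β) {f : T → ℂ}
    (hf : MemLp f p m) {r : ℝ} (θ : ℝ) (hr : 0 ≤ r) (hr1 : r < 1) :
    ‖dZbar (poissonIntegral α β f) (polar r θ)‖ ≤ Efun β α p r / weight p r * lpNorm p f := by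
  rw [dZbar_poissonIntegral h hr hr1 (hf.integrable hp)]
  refine (norm_polarIntegral_le hp h hr hr1 θ _ _ hf).trans
    (div_weight_mul_lpNorm_le p hr hr1 f ?_)
  rw [sharpConst_unit hp]
  exact sharpConst_zero_one_le_Efun hp h hr hr1

theorem Cfun_le_Cconst {p : ℝ≥0∞} (hp : 1 ≤ p) {α β r : ℝ} (h : Admissible α β) (hr : 0 ≤ r)
    (hr1 : r < 1) : Cfun α β p r ≤ Cconst α β p :=
  le_sSup_image_Ioo (continuousOn_Cfun_slice hp h) ⟨hr, hr1.le⟩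

theorem Efun_le_Econst {p : ℝ≥0∞} (hp : 1 ≤ p) {α β r : ℝ} (h : Admissible α β) (hr : 0 ≤ r)
    (hr1 : r < 1) : Efun α β p r ≤ Econst α β p :=
  le_sSup_image_Ioo (continuousOn_Efun_slice hp h) ⟨hr, hr1.le⟩

/-- If $F(r)$ does not exceed the exact constant at radius $r$, then duality at each single radius
forces every valid $K$ to be at least $F(r)$. Looking at $\theta=0$ is enough. -/
theorem isLeast_validConstants {p : ℝ≥0∞} (hp : 1 ≤ p) {α β : ℝ} (h : Admissible α β)
    {Q : (ℂ → ℂ) → ℝ → ℝ → ℂ} {X Y : ℝ → ℝ → ℂ}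
    (hQ : ∀ f : T → ℂ, Integrable f m → ∀ r θ : ℝ, 0 ≤ r → r < 1 →
      Q (poissonIntegral α β f) r θ = polarIntegral α β f r θ (X r θ) (Y r θ))
    {F : ℝ → ℝ} (hF : ∀ r ∈ Ioo (0 : ℝ) 1, F r ≤ sharpConst α β p r (X r 0) (Y r 0))
    (hv : sSup (F '' Ioo 0 1) ∈ validConstants Q p α β) :
    IsLeast (validConstants Q p α β) (sSup (F '' Ioo 0 1)) := by
  refine ⟨hv, fun K hK => csSup_le (nonempty_image_Ioo F) ?_⟩
  rintro _ ⟨r, hr, rfl⟩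
  refine (hF r hr).trans (sharpConst_le hp h hr.1.le hr.2 0 _ _ fun f hf => ?_)
  have := hK f hf r 0 hr.1.le hr.2
  rwa [hQ f (hf.integrable hp) r 0 hr.1.le hr.2] at this

/-! ### Asymptotic sharpness as the parameters tend to zero -/

theorem eventually_admissible : ∀ᶠ x : ℝ × ℝ in 𝓝 (0, 0), Admissible x.1 x.2 := by
  have hU : IsOpen {x : ℝ × ℝ | -(1 / 2) < x.1 ∧ -(1 / 2) < x.2} :=
    (isOpen_lt continuous_const continuous_fst).inter (isOpen_lt continuous_const continuous_snd)
  filter_upwards [hU.mem_nhds (by norm_num : ((0 : ℝ), (0 : ℝ)) ∈ _)] with x hx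
  have h1 : -(1 / 2) < x.1 := hx.1
  have h2 : -(1 / 2) < x.2 := hx.2
  refine ⟨fun n hn => ?_, fun n hn => ?_, by linarith⟩
  · have : (0 : ℝ) ≤ n := n.cast_nonneg
    linarith
  · have : (0 : ℝ) ≤ n := n.cast_nonneg
    linarith

/-- Dominated convergence: on a compact neighbourhood of $(0,0)$ consisting of admissible
parameters, the kernel is bounded uniformly in the parameters and in $\tau$. -/
theorem continuousAt_polarIntegral {f : T → ℂ} (hf : Integrable f m) {r : ℝ} (hr : 0 ≤ r)
    (hr1 : r < 1) (θ : ℝ) (x y : ℂ) :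
    ContinuousAt (fun a : ℝ × ℝ => polarIntegral a.1 a.2 f r θ x y) (0, 0) := by
  obtain ⟨N, hN, hNS, hNc⟩ := local_compact_nhds eventually_admissible
  have hk := continuousOn_polarKernel hr hr1 x y
  have hNS' : N ×ˢ univ ⊆ {w : (ℝ × ℝ) × T | Admissible w.1.1 w.1.2} := fun w hw => hNS hw.1
  obtain ⟨M, hM⟩ := (hNc.prod (isCompact_univ (X := T))).exists_bound_of_continuousOn (hk.mono hNS')
  refine continuousAt_of_dominated (bound := fun t => M * ‖f t‖) ?_ ?_ (hf.norm.const_mul M) ?_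
  · filter_upwards [eventually_admissible] with a ha
    exact (integrable_polarKernel_mul ha hr hr1 x y _ hf).1
  · filter_upwards [hN] with a ha
    refine Eventually.of_forall fun t => ?_
    rw [norm_mul]
    exact mul_le_mul_of_nonneg_right (hM (a, (θ : T) - t) ⟨ha, mem_univ _⟩) (norm_nonneg _)
  · refine Eventually.of_forall fun t => ContinuousAt.mul ?_ continuousAt_const
    have h1 : ContinuousOn (fun a : ℝ × ℝ => polarKernel a.1 a.2 r x y ((θ : T) - t))
        {a | Admissible a.1 a.2} :=
      hk.comp (f := fun a : ℝ × ℝ => (a, (θ : T) - t)) (by fun_prop) fun a ha => ha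
    exact h1.continuousAt eventually_admissible

/-- Minimality at $(0,0)$ supplies $f$, $r$, $\theta$ violating the estimate with constant
$K(0,0)/(1+\delta)$. The violation is a strict inequality between quantities continuous in
$(\alpha,\beta)$, so it persists nearby and every valid $K'$ there exceeds $K(0,0)/(1+\delta)$.
Continuity gives $K(\alpha,\beta)<(1+\delta)K(0,0)$ as well. -/
theorem asymptoticallySharp_of_isLeast {p : ℝ≥0∞} (hp : 1 ≤ p)
    {Q : (ℂ → ℂ) → ℝ → ℝ → ℂ} {X Y : ℝ → ℝ → ℂ}
    (hQ : ∀ α β : ℝ, Admissible α β → ∀ f : T → ℂ, Integrable f m → ∀ r θ : ℝ, 0 ≤ r → r < 1 →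
      Q (poissonIntegral α β f) r θ = polarIntegral α β f r θ (X r θ) (Y r θ))
    {K : ℝ → ℝ → ℝ} (hK : IsLeast (validConstants Q p 0 0) (K 0 0))
    (hcont : ContinuousAt (fun x : ℝ × ℝ => K x.1 x.2) (0, 0)) (hpos : 0 < K 0 0) :
    AsymptoticallySharp Q p K := by
  refine ⟨hK, hcont, fun ε hε => ?_⟩
  obtain ⟨δ, hδ, hδε⟩ : ∃ δ : ℝ, 0 < δ ∧ (1 + δ) ^ 2 ≤ 1 + ε := by
    -- For $\delta\le1$ one has $(1+\delta)^2\le1+3\delta$.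
    refine ⟨min 1 (ε / 3), by positivity, ?_⟩
    have h1 := min_le_left 1 (ε / 3)
    have h2 := min_le_right 1 (ε / 3)
    have h3 : 0 < min 1 (ε / 3) := by positivity
    nlinarith
  have hlt : K 0 0 / (1 + δ) < K 0 0 := div_lt_self hpos (by linarith)
  have hnot : K 0 0 / (1 + δ) ∉ validConstants Q p 0 0 := fun hmem => (hK.2 hmem).not_gt hlt
  simp only [validConstants, mem_ofPred_eq, not_forall, not_le] at hnot
  obtain ⟨f, hf, r, θ, hr, hr1, hfr⟩ := hnot
  have hfi := hf.integrable hp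
  have hw := weight_pos p hr hr1
  rw [hQ 0 0 admissible_zero f hfi r θ hr hr1] at hfr
  have h1 := (continuousAt_polarIntegral hfi hr hr1 θ (X r θ) (Y r θ)).norm.eventually_const_lt hfr
  have h2 := hcont.eventually_lt_const (show K 0 0 < K 0 0 * (1 + δ) by nlinarith)
  filter_upwards [h1, h2, eventually_admissible] with x hx1 hx2 hx K' hK'
  have h3 := hK' f hf r θ hr hr1
  rw [hQ x.1 x.2 hx f hfi r θ hr hr1] at h3
  have h4 : K 0 0 / (1 + δ) < K' := by
    have h5 := lt_of_mul_lt_mul_right (hx1.trans_le h3) (lpNorm_nonneg p f)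
    exact (div_lt_div_iff_of_pos_right hw).1 h5
  rw [div_lt_iff₀ (by linarith)] at h4
  have hK'0 : 0 < K' := by
    by_contra! hneg
    nlinarith
  calc K x.1 x.2 ≤ K 0 0 * (1 + δ) := hx2.le
    _ ≤ K' * (1 + δ) * (1 + δ) := by gcongr
    _ = (1 + δ) ^ 2 * K' := by ring
    _ ≤ (1 + ε) * K' := by gcongr

theorem Cconst_mem_validConstants {p : ℝ≥0∞} (hp : 1 ≤ p) {α β : ℝ} (h : Admissible α β) :
    Cconst α β p ∈ validConstants dR p α β := fun f hf _ θ hr hr1 =>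
  (norm_dR_le hp h hf θ hr hr1).trans
    (div_weight_mul_lpNorm_le p hr hr1 f (Cfun_le_Cconst hp h hr hr1))

theorem Dconst_mem_validConstants {p : ℝ≥0∞} (hp : 1 ≤ p) {α β : ℝ} (h : Admissible α β) :
    Dconst α β p ∈ validConstants dTheta p α β := fun f hf _ θ hr hr1 =>
  (norm_dTheta_le hp h hf θ hr hr1).trans
    (div_weight_mul_lpNorm_le p hr hr1 f (Dfun_le_Dconst hp h hr hr1))

theorem Econst_mem_validConstants {p : ℝ≥0∞} (hp : 1 ≤ p) {α β : ℝ} (h : Admissible α β) :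
    Econst α β p ∈ validConstants (fun u r θ => dZ u (polar r θ)) p α β := fun f hf _ θ hr hr1 =>
  (norm_dZ_le hp h hf θ hr hr1).trans
    (div_weight_mul_lpNorm_le p hr hr1 f (Efun_le_Econst hp h hr hr1))

theorem Econst_symm_mem_validConstants {p : ℝ≥0∞} (hp : 1 ≤ p) {α β : ℝ} (h : Admissible α β) :
    Econst β α p ∈ validConstants (fun u r θ => dZbar u (polar r θ)) p α β :=
  fun f hf _ θ hr hr1 => (norm_dZbar_le hp h hf θ hr hr1).trans
    (div_weight_mul_lpNorm_le p hr hr1 f (Efun_le_Econst hp h.symm hr hr1))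

theorem normConst_zero : normConst 0 0 = 1 := by
  simp [normConst]

theorem Cconst_zero_pos {p : ℝ≥0∞} (hp : 1 ≤ p) : 0 < Cconst 0 0 p := by
  refine lt_of_lt_of_le ?_ (Cfun_le_Cconst hp admissible_zero (r := 1 / 2) (by norm_num)
    (by norm_num))
  unfold Cfun
  rw [normConst_zero]
  split_ifs with hp1
  · norm_num
  · obtain ⟨hq, -, -⟩ := conjExp_holder hp hp1
    simp only
    have hI : 0 < I11 0 0 (conjExp p) (1 / 2) := by
      have hc : Continuous fun s =>
          (|(0 + 0 + 2) * Real.cos s| + |(0 : ℝ) - 0|) ^ conjExp p *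
            distSq (1 / 2) s ^ (((0 + 0 + 2) * conjExp p - 2) / 2) :=
        (Continuous.rpow_const (by fun_prop) fun _ => Or.inr (by linarith)).mul
          (continuous_distSq_rpow (by norm_num) (by norm_num) _)
      rw [I11_eq]
      refine intervalIntegral.integral_pos Real.two_pi_pos hc.continuousOn (fun s _ =>
        mul_nonneg (by positivity) (Real.rpow_nonneg (distSq_nonneg _ _) _))
        ⟨0, ⟨le_rfl, Real.two_pi_pos.le⟩, mul_pos (Real.rpow_pos_of_pos ?_ _)
          (Real.rpow_pos_of_pos (distSq_pos (by norm_num) (by norm_num) _) _)⟩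
      norm_num
    simp only [add_zero, abs_zero, mul_zero, zero_mul, zero_div, abs_one, one_mul]
    positivity

theorem Econst_zero_pos {p : ℝ≥0∞} (hp : 1 ≤ p) : 0 < Econst 0 0 p := by
  rw [Econst_eq_Eclosed hp admissible_zero]
  unfold Eclosed
  rw [normConst_zero]
  split_ifs with hp1
  · norm_num
  · obtain ⟨hq, -, -⟩ := conjExp_holder hp hp1
    simp only
    have h1 := Real.Gamma_pos_of_pos (show 0 < (0 + 0 + 2) * conjExp p - 1 by linarith)
    have h2 := Real.Gamma_pos_of_pos (show 0 < (0 + 0 + 2) * conjExp p / 2 by linarith)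
    have h3 : (0 : ℝ) < |0 + 1| + |0| := by norm_num
    have h4 : (0 : ℝ) < |1| := by norm_num
    positivity

theorem continuousAt_Cconst {p : ℝ≥0∞} (hp : 1 ≤ p) :
    ContinuousAt (fun x : ℝ × ℝ => Cconst x.1 x.2 p) (0, 0) :=
  (continuousOn_sSup_image (continuousOn_Cfun hp)).continuousAt eventually_admissible

theorem continuousAt_Econst {p : ℝ≥0∞} (hp : 1 ≤ p) :
    ContinuousAt (fun x : ℝ × ℝ => Econst x.1 x.2 p) (0, 0) :=
  (continuousOn_sSup_image (continuousOn_Efun hp)).continuousAt eventually_admissible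

theorem continuousAt_Econst_swap {p : ℝ≥0∞} (hp : 1 ≤ p) :
    ContinuousAt (fun x : ℝ × ℝ => Econst x.2 x.1 p) (0, 0) :=
  ContinuousAt.comp' (f := Prod.swap) (x := ((0 : ℝ), (0 : ℝ)))
    (g := fun x : ℝ × ℝ => Econst x.1 x.2 p) (continuousAt_Econst hp) continuous_swap.continuousAt

theorem asymptoticallySharp_Cconst {p : ℝ≥0∞} (hp : 1 ≤ p) :
    AsymptoticallySharp dR p (fun α β => Cconst α β p) := by
  refine asymptoticallySharp_of_isLeast hp (X := fun _ _ => 1) (Y := fun _ _ => 1)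
    (fun α β h f hf r θ hr hr1 => dR_poissonIntegral h hr hr1 hf θ) ?_
    (continuousAt_Cconst hp) (Cconst_zero_pos hp)
  exact isLeast_validConstants hp admissible_zero (X := fun _ _ => 1) (Y := fun _ _ => 1)
    (fun f hf r θ hr hr1 => dR_poissonIntegral admissible_zero hr hr1 hf θ)
    (fun r hr => Cfun_zero_le_sharpConst hr.1.le hr.2)
    (Cconst_mem_validConstants hp admissible_zero)

theorem isLeast_Dconst {p : ℝ≥0∞} (hp : 1 ≤ p) {α : ℝ} (h : Admissible α α) :
    IsLeast (validConstants dTheta p α α) (Dconst α α p) :=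
  isLeast_validConstants hp h (X := fun r _ => Complex.I * r) (Y := fun r _ => -(Complex.I * r))
    (fun _ hf _ θ hr hr1 => dTheta_poissonIntegral h hr hr1 hf θ)
    (fun _ hr => Dfun_self_le_sharpConst hp α hr.1.le) (Dconst_mem_validConstants hp h)

theorem asymptoticallySharp_Econst {p : ℝ≥0∞} (hp : 1 ≤ p) :
    AsymptoticallySharp (fun u r θ => dZ u (polar r θ)) p (fun α β => Econst α β p) := by
  refine asymptoticallySharp_of_isLeast hp (X := fun _ θ => conj (unit (θ : T))) (Y := fun _ _ => 0)
    (fun α β h f hf r θ hr hr1 => dZ_poissonIntegral h hr hr1 hf θ) ?_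
    (continuousAt_Econst hp) (Econst_zero_pos hp)
  refine isLeast_validConstants hp admissible_zero (X := fun _ θ => conj (unit (θ : T)))
    (Y := fun _ _ => 0)
    (fun f hf r θ hr hr1 => dZ_poissonIntegral admissible_zero hr hr1 hf θ)
    (fun r hr => ?_) (Econst_mem_validConstants hp admissible_zero)
  rw [sharpConst_conj_unit hp]
  exact Efun_zero_le_sharpConst hr.1.le hr.2 (norm_trigPoly_zero_one_zero r)

theorem asymptoticallySharp_Econst_swap {p : ℝ≥0∞} (hp : 1 ≤ p) :
    AsymptoticallySharp (fun u r θ => dZbar u (polar r θ)) p (fun α β => Econst β α p) := by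
  refine asymptoticallySharp_of_isLeast hp (X := fun _ _ => 0) (Y := fun _ θ => unit (θ : T))
    (fun α β h f hf r θ hr hr1 => dZbar_poissonIntegral h hr hr1 hf θ) ?_
    (continuousAt_Econst_swap hp) (Econst_zero_pos hp)
  refine isLeast_validConstants hp admissible_zero (X := fun _ _ => 0)
    (Y := fun _ θ => unit (θ : T))
    (fun f hf r θ hr hr1 => dZbar_poissonIntegral admissible_zero hr hr1 hf θ)
    (fun r hr => ?_) (Econst_symm_mem_validConstants hp admissible_zero)
  rw [sharpConst_unit hp]
  exact Efun_zero_le_sharpConst hr.1.le hr.2 (norm_trigPoly_zero_zero_one r)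

end AlphaBeta

end

theorem mainTheorem11 (p : ℝ≥0∞) (hp : 1 ≤ p) :
    -- the pointwise bounds
    (∀ α β : ℝ, AlphaBeta.Admissible α β →
      IsLUB (AlphaBeta.Cfun α β p '' Ioo 0 1) (AlphaBeta.Cconst α β p) ∧
      IsLUB (AlphaBeta.Dfun α β p '' Ioo 0 1) (AlphaBeta.Dconst α β p) ∧
      IsLUB (AlphaBeta.Efun α β p '' Ioo 0 1) (AlphaBeta.Econst α β p) ∧
      AlphaBeta.Econst α β p = AlphaBeta.Eclosed α β p ∧
      ∀ f : AlphaBeta.T → ℂ, MemLp f p AlphaBeta.m →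
        (∀ z : ℂ, ‖z‖ < 1 → DifferentiableAt ℝ (AlphaBeta.poissonIntegral α β f) z) ∧
        ∀ r θ : ℝ, 0 ≤ r → r < 1 →
          (‖AlphaBeta.dR (AlphaBeta.poissonIntegral α β f) r θ‖
              ≤ AlphaBeta.Cfun α β p r / AlphaBeta.weight p r * AlphaBeta.lpNorm p f ∧
            AlphaBeta.Cfun α β p r / AlphaBeta.weight p r * AlphaBeta.lpNorm p f
              ≤ AlphaBeta.Cconst α β p / AlphaBeta.weight p r * AlphaBeta.lpNorm p f) ∧
          (‖AlphaBeta.dTheta (AlphaBeta.poissonIntegral α β f) r θ‖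
              ≤ AlphaBeta.Dfun α β p r / AlphaBeta.weight p r * AlphaBeta.lpNorm p f ∧
            AlphaBeta.Dfun α β p r / AlphaBeta.weight p r * AlphaBeta.lpNorm p f
              ≤ AlphaBeta.Dconst α β p / AlphaBeta.weight p r * AlphaBeta.lpNorm p f) ∧
          (‖AlphaBeta.dZ (AlphaBeta.poissonIntegral α β f) (AlphaBeta.polar r θ)‖
              ≤ AlphaBeta.Efun α β p r / AlphaBeta.weight p r * AlphaBeta.lpNorm p f ∧
            AlphaBeta.Efun α β p r / AlphaBeta.weight p r * AlphaBeta.lpNorm p f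
              ≤ AlphaBeta.Econst α β p / AlphaBeta.weight p r * AlphaBeta.lpNorm p f) ∧
          (‖AlphaBeta.dZbar (AlphaBeta.poissonIntegral α β f) (AlphaBeta.polar r θ)‖
              ≤ AlphaBeta.Efun β α p r / AlphaBeta.weight p r * AlphaBeta.lpNorm p f ∧
            AlphaBeta.Efun β α p r / AlphaBeta.weight p r * AlphaBeta.lpNorm p f
              ≤ AlphaBeta.Econst β α p / AlphaBeta.weight p r * AlphaBeta.lpNorm p f)) ∧
    -- asymptotic sharpness of the constant for the radial derivative
    AlphaBeta.AsymptoticallySharp AlphaBeta.dR p (fun α β => AlphaBeta.Cconst α β p) ∧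
    -- sharpness of the constant for the angular derivative when the parameters agree
    (∀ α : ℝ, AlphaBeta.Admissible α α →
      IsLeast (AlphaBeta.validConstants AlphaBeta.dTheta p α α) (AlphaBeta.Dconst α α p)) ∧
    -- asymptotic sharpness of the constants for the two Wirtinger derivatives
    AlphaBeta.AsymptoticallySharp (fun u r θ => AlphaBeta.dZ u (AlphaBeta.polar r θ)) p
      (fun α β => AlphaBeta.Econst α β p) ∧
    AlphaBeta.AsymptoticallySharp (fun u r θ => AlphaBeta.dZbar u (AlphaBeta.polar r θ)) p
      (fun α β => AlphaBeta.Econst β α p) := by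
  open AlphaBeta in
  refine ⟨fun α β h => ⟨(isLUB_image_Ioo (continuousOn_Cfun_slice hp h)).1,
    isLUB_csSup (nonempty_image_Ioo _) (bddAbove_Dfun hp h),
    (isLUB_image_Ioo (continuousOn_Efun_slice hp h)).1, Econst_eq_Eclosed hp h,
    fun f hf => ⟨fun z hz => differentiableAt_poissonIntegral h (hf.integrable hp) hz,
      fun r θ hr hr1 => ⟨⟨norm_dR_le hp h hf θ hr hr1, ?_⟩, ⟨norm_dTheta_le hp h hf θ hr hr1, ?_⟩,
        ⟨norm_dZ_le hp h hf θ hr hr1, ?_⟩, ⟨norm_dZbar_le hp h hf θ hr hr1, ?_⟩⟩⟩⟩,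
    asymptoticallySharp_Cconst hp, fun α h => isLeast_Dconst hp h,
    asymptoticallySharp_Econst hp, asymptoticallySharp_Econst_swap hp⟩
  · exact div_weight_mul_lpNorm_le p hr hr1 f (Cfun_le_Cconst hp h hr hr1)
  · exact div_weight_mul_lpNorm_le p hr hr1 f (Dfun_le_Dconst hp h hr hr1)
  · exact div_weight_mul_lpNorm_le p hr hr1 f (Efun_le_Econst hp h hr hr1)
  · exact div_weight_mul_lpNorm_le p hr hr1 f (Efun_le_Econst hp h.symm hr hr1)
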